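/- Let $\Omega\subset\mathbb R^2$ be a polygonal domain, i.e. a bounded, connected, nonempty open set whose boundary is a finite union of (nondegenerate, closed) line segments. Let $\varepsilon,\mu$ be real measurable functions on $\Omega$ with $0<\underline\varepsilon\le\varepsilon\le\overline\varepsilon$ and $0<\underline\mu\le\mu\le\overline\mu$ almost everywhere in $\Omega$, for some constants $\underline\varepsilon,\overline\varepsilon,\underline\mu,\overline\mu$. Write $(\cdot,\cdot)$ for the scalar product of $L^2(\Omega)$ and of $L^2(\Omega)^2$ and, in the sense of distributions, $$\operatorname{rot}\mathbf v=\partial_x v_2-\partial_y v_1,\qquad \operatorname{\mathbf{curl}} q=(\partial_y q,-\partial_x q)^\top .$$ Let $V=H_0(\operatorname{rot};\Omega)$ be the space of all $\mathbf v\in L^2(\Omega)^2$ with $\operatorname{rot}\mathbf v\in L^2(\Omega)$ and vanishing tangential component on $\partial\Omega$, that is, the closure of $C_c^\infty(\Omega)^2$ in the norm $(\|\mathbf v\|_0^2+\|\operatorname{rot}\mathbf v\|_0^2)^{1/2}$, and let $Q=\{q\in H^1(\Omega):\ \int_\Omega\mu q\,d\mathbf x=0\}$. Equip them with the norms $$\|\mathbf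 v\|_V^2=(\varepsilon\mathbf v,\mathbf v)+(\mu^{-1}\operatorname{rot}\mathbf v,\operatorname{rot}\mathbf v),\qquad \|q\|_Q^2=(\varepsilon^{-1}\operatorname{\mathbf{curl}}q,\operatorname{\mathbf{curl}}q).$$ Let $a:(V\times Q)\times(V\times Q)\to\mathbb R$ be the bilinear form $$a(\mathbf u,p;\mathbf v,q)=(\mu^{-1}\operatorname{rot}\mathbf u,\operatorname{rot}\mathbf v)+(\varepsilon^{1/2}\mathbf u-\varepsilon^{-1/2}\operatorname{\mathbf{curl}}p,\ \varepsilon^{1/2}\mathbf v-\varepsilon^{-1/2}\operatorname{\mathbf{curl}}q).$$ Then there exists $\alpha>0$ such that $$a(\mathbf v,q;\mathbf v,q)\ge\alpha\left(\|\mathbf v\|_V^2+\|q\|_Q^2\right)\qquad\text{for all }(\mathbf v,q)\in V\times Q.$$ -/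

import Mathlib

open MeasureTheory Filter Topology
open scoped ContDiff

noncomputable section

namespace Maxwell2D

/-- The Euclidean plane. -/
abbrev Plane : Type := EuclideanSpace ℝ (Fin 2)

/-- A polygonal domain: a bounded, connected, nonempty open subset of the plane whose boundary is a
finite union of nondegenerate closed line segments (reentrant corners, holes and cracks allowed). -/
structure IsPolygonalDomain (Ω : Set Plane) : Prop where
  isOpen : IsOpen Ω
  isConnected : IsConnected Ω
  isBounded : Bornology.IsBounded Ω
  boundary : ∃ S : Finset (Plane × Plane), (∀ s ∈ S, s.1 ≠ s.2) ∧
    frontier Ω = ⋃ s ∈ S, segment ℝ s.1 s.2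

/-- A real coefficient on `Ω` that is measurable and bounded above and below, almost everywhere
in `Ω`, by positive constants. -/
structure IsAdmissibleCoeff (Ω : Set Plane) (c : Plane → ℝ) : Prop where
  aemeasurable : AEMeasurable c (volume.restrict Ω)
  bounds : ∃ lo hi : ℝ, 0 < lo ∧ ∀ᵐ x ∂(volume.restrict Ω), lo ≤ c x ∧ c x ≤ hi

/-- `L²(Ω)`. -/
abbrev L2Scalar (Ω : Set Plane) : Type := Lp ℝ 2 (volume.restrict Ω)

/-- `L²(Ω)²`. -/
abbrev L2Vector (Ω : Set Plane) : Type := Lp Plane 2 (volume.restrict Ω)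

/-- Smooth functions with compact support in `Ω`. -/
def IsTest {F : Type*} [NormedAddCommGroup F] [NormedSpace ℝ F] (Ω : Set Plane)
    (φ : Plane → F) : Prop :=
  ContDiff ℝ ∞ φ ∧ HasCompactSupport φ ∧ tsupport φ ⊆ Ω

/-- Classical partial derivative in the direction of the `i`-th coordinate. -/
def pderiv {F : Type*} [NormedAddCommGroup F] [NormedSpace ℝ F] (i : Fin 2)
    (φ : Plane → F) (x : Plane) : F :=
  fderiv ℝ φ x (EuclideanSpace.single i 1)

/-- Classical `curl φ = (∂φ/∂y, -∂φ/∂x)`. -/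
def classicalCurl (φ : Plane → ℝ) (x : Plane) : Plane :=
  !₂[pderiv 1 φ x, -pderiv 0 φ x]

/-- Classical `rot Φ = ∂Φ₂/∂x - ∂Φ₁/∂y`. -/
def classicalRot (Φ : Plane → Plane) (x : Plane) : ℝ :=
  pderiv 0 Φ x 1 - pderiv 1 Φ x 0

theorem IsTest.add {F : Type*} [NormedAddCommGroup F] [NormedSpace ℝ F] {Ω : Set Plane}
    {φ ψ : Plane → F} (hφ : IsTest Ω φ) (hψ : IsTest Ω ψ) : IsTest Ω (φ + ψ) :=
  ⟨hφ.1.add hψ.1, hφ.2.1.add hψ.2.1,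
    (tsupport_add φ ψ).trans (Set.union_subset hφ.2.2 hψ.2.2)⟩

theorem IsTest.const_smul {F : Type*} [NormedAddCommGroup F] [NormedSpace ℝ F] {Ω : Set Plane}
    {φ : Plane → F} (c : ℝ) (hφ : IsTest Ω φ) : IsTest Ω (c • φ) :=
  ⟨contDiff_const.smul hφ.1, hφ.2.1.smul_left (f := fun _ => c),
    (tsupport_smul_subset_right (fun _ => c) φ).trans hφ.2.2⟩

theorem IsTest.zero {F : Type*} [NormedAddCommGroup F] [NormedSpace ℝ F] {Ω : Set Plane} :
    IsTest Ω (0 : Plane → F) :=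
  ⟨contDiff_const, HasCompactSupport.zero, by simp [tsupport]⟩

theorem IsTest.memLp {F : Type*} [NormedAddCommGroup F] [NormedSpace ℝ F] {Ω : Set Plane}
    {φ : Plane → F} (hφ : IsTest Ω φ) : MemLp φ 2 (volume.restrict Ω) :=
  (hφ.1.continuous.memLp_of_hasCompactSupport hφ.2.1).restrict Ω

theorem IsTest.continuous_pderiv {F : Type*} [NormedAddCommGroup F] [NormedSpace ℝ F]
    {Ω : Set Plane} {φ : Plane → F} (i : Fin 2) (hφ : IsTest Ω φ) : Continuous (pderiv i φ) :=
  (hφ.1.continuous_fderiv (by simp)).clm_apply continuous_const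

theorem IsTest.compact_pderiv {F : Type*} [NormedAddCommGroup F] [NormedSpace ℝ F]
    {Ω : Set Plane} {φ : Plane → F} (i : Fin 2) (hφ : IsTest Ω φ) :
    HasCompactSupport (pderiv i φ) :=
  hφ.2.1.fderiv_apply ℝ _

theorem IsTest.memLp_pderiv {F : Type*} [NormedAddCommGroup F] [NormedSpace ℝ F]
    {Ω : Set Plane} {φ : Plane → F} (i : Fin 2) (hφ : IsTest Ω φ) :
    MemLp (pderiv i φ) 2 (volume.restrict Ω) :=
  ((hφ.continuous_pderiv i).memLp_of_hasCompactSupport (hφ.compact_pderiv i)).restrict Ω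

theorem IsTest.continuous_curl {Ω : Set Plane} {φ : Plane → ℝ} (hφ : IsTest Ω φ) :
    Continuous (classicalCurl φ) := by
  have h0 := hφ.continuous_pderiv 0
  have h1 := hφ.continuous_pderiv 1
  refine (PiLp.continuous_toLp 2 _).comp (continuous_pi fun i => ?_)
  fin_cases i
  · simpa using h1
  · exact h0.neg

theorem IsTest.memLp_curl {Ω : Set Plane} {φ : Plane → ℝ} (hφ : IsTest Ω φ) :
    MemLp (classicalCurl φ) 2 (volume.restrict Ω) := by
  refine (hφ.continuous_curl.memLp_of_hasCompactSupport ?_).restrict Ω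
  refine ((hφ.compact_pderiv 0).isCompact.union (hφ.compact_pderiv 1).isCompact).of_isClosed_subset
    (isClosed_tsupport _) (closure_minimal ?_ (by
      exact (isClosed_tsupport _).union (isClosed_tsupport _)))
  intro x hx
  by_contra hn
  simp only [Set.mem_union, not_or] at hn
  apply hx
  have e0 := image_eq_zero_of_notMem_tsupport hn.1
  have e1 := image_eq_zero_of_notMem_tsupport hn.2
  ext i
  fin_cases i <;> simp [classicalCurl, e0, e1]

theorem IsTest.memLp_rot {Ω : Set Plane} {Φ : Plane → Plane} (hΦ : IsTest Ω Φ) :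
    MemLp (classicalRot Φ) 2 (volume.restrict Ω) :=
  MemLp.sub
    ((EuclideanSpace.proj 1 : Plane →L[ℝ] ℝ).comp_memLp' (hΦ.memLp_pderiv 0))
    ((EuclideanSpace.proj 0 : Plane →L[ℝ] ℝ).comp_memLp' (hΦ.memLp_pderiv 1))

theorem classicalRot_add {Ω : Set Plane} {Φ Ψ : Plane → Plane} (hΦ : IsTest Ω Φ)
    (hΨ : IsTest Ω Ψ) : classicalRot (Φ + Ψ) = classicalRot Φ + classicalRot Ψ := by
  funext x
  have h1 := (hΦ.1.differentiable (by simp)) x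
  have h2 := (hΨ.1.differentiable (by simp)) x
  simp only [classicalRot, pderiv, fderiv_add h1 h2, Pi.add_apply, add_apply,
    PiLp.add_apply]
  ring

theorem classicalRot_const_smul {Ω : Set Plane} {Φ : Plane → Plane} (c : ℝ) (hΦ : IsTest Ω Φ) :
    classicalRot (c • Φ) = c • classicalRot Φ := by
  funext x
  have h1 := (hΦ.1.differentiable (by simp)) x
  simp only [classicalRot, pderiv, fderiv_const_smul h1, Pi.smul_apply,
    smul_apply, PiLp.smul_apply, smul_eq_mul]
  ring

theorem integrable_mul_of_memLp {Ω : Set Plane} {f g : Plane → ℝ}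
    (hf : MemLp f 2 (volume.restrict Ω)) (hg : MemLp g 2 (volume.restrict Ω)) :
    Integrable (fun x => f x * g x) (volume.restrict Ω) :=
  hf.integrable_mul hg

theorem integrable_inner_of_memLp {Ω : Set Plane} {f g : Plane → Plane}
    (hf : MemLp f 2 (volume.restrict Ω)) (hg : MemLp g 2 (volume.restrict Ω)) :
    Integrable (fun x => inner ℝ (f x) (g x)) (volume.restrict Ω) := by
  refine (hf.norm.integrable_mul hg.norm).mono (hf.1.inner hg.1) (ae_of_all _ fun x => ?_)
  simpa using norm_inner_le_norm (𝕜 := ℝ) (f x) (g x)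

/-- `w` is the distributional `rot` of `v` in `Ω`. -/
def HasWeakRot (Ω : Set Plane) (v : L2Vector Ω) (w : L2Scalar Ω) : Prop :=
  ∀ φ : Plane → ℝ, IsTest Ω φ →
    ∫ x in Ω, inner ℝ (v x) (classicalCurl φ x) = ∫ x in Ω, w x * φ x

/-- `g` is the distributional partial derivative of `q` in `Ω` along the `i`-th coordinate. -/
def HasWeakPDeriv (Ω : Set Plane) (i : Fin 2) (q g : L2Scalar Ω) : Prop :=
  ∀ φ : Plane → ℝ, IsTest Ω φ →
    ∫ x in Ω, q x * pderiv i φ x = -∫ x in Ω, g x * φ x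

theorem HasWeakRot.zero {Ω : Set Plane} : HasWeakRot Ω 0 0 := by
  intro φ _
  have h1 : ∫ x in Ω, inner ℝ ((0 : L2Vector Ω) x) (classicalCurl φ x) = 0 := by
    refine integral_eq_zero_of_ae ?_
    filter_upwards [Lp.coeFn_zero Plane 2 (volume.restrict Ω)] with x hx
    rw [hx]
    simp
  have h2 : ∫ x in Ω, (0 : L2Scalar Ω) x * φ x = 0 := by
    refine integral_eq_zero_of_ae ?_
    filter_upwards [Lp.coeFn_zero ℝ 2 (volume.restrict Ω)] with x hx
    rw [hx]
    simp
  rw [h1, h2]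

theorem HasWeakRot.add {Ω : Set Plane} {v v' : L2Vector Ω} {w w' : L2Scalar Ω}
    (h : HasWeakRot Ω v w) (h' : HasWeakRot Ω v' w') : HasWeakRot Ω (v + v') (w + w') := by
  intro φ hφ
  have h1 : ∫ x in Ω, inner ℝ ((v + v') x) (classicalCurl φ x) =
      ∫ x in Ω, (inner ℝ (v x) (classicalCurl φ x) + inner ℝ (v' x) (classicalCurl φ x)) := by
    refine integral_congr_ae ?_
    filter_upwards [Lp.coeFn_add v v'] with x hx
    rw [hx]
    simp [inner_add_left]
  have h2 : ∫ x in Ω, (w + w') x * φ x = ∫ x in Ω, (w x * φ x + w' x * φ x) := by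
    refine integral_congr_ae ?_
    filter_upwards [Lp.coeFn_add w w'] with x hx
    rw [hx]
    simp [add_mul]
  rw [h1, h2, integral_add (integrable_inner_of_memLp (Lp.memLp v) hφ.memLp_curl)
    (integrable_inner_of_memLp (Lp.memLp v') hφ.memLp_curl),
    integral_add (integrable_mul_of_memLp (Lp.memLp w) hφ.memLp)
    (integrable_mul_of_memLp (Lp.memLp w') hφ.memLp), h φ hφ, h' φ hφ]

theorem HasWeakRot.const_smul {Ω : Set Plane} {v : L2Vector Ω} {w : L2Scalar Ω} (c : ℝ)
    (h : HasWeakRot Ω v w) : HasWeakRot Ω (c • v) (c • w) := by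
  intro φ hφ
  have h1 : ∫ x in Ω, inner ℝ ((c • v) x) (classicalCurl φ x) =
      ∫ x in Ω, c * inner ℝ (v x) (classicalCurl φ x) := by
    refine integral_congr_ae ?_
    filter_upwards [Lp.coeFn_smul c v] with x hx
    rw [hx]
    simp [inner_smul_left]
  have h2 : ∫ x in Ω, (c • w) x * φ x = ∫ x in Ω, c * (w x * φ x) := by
    refine integral_congr_ae ?_
    filter_upwards [Lp.coeFn_smul c w] with x hx
    rw [hx]
    simp [mul_assoc]
  rw [h1, h2, integral_const_mul, integral_const_mul, h φ hφ]

theorem HasWeakPDeriv.zero {Ω : Set Plane} {i : Fin 2} : HasWeakPDeriv Ω i 0 0 := by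
  intro φ _
  have h (ψ : Plane → ℝ) : ∫ x in Ω, (0 : L2Scalar Ω) x * ψ x = 0 := by
    refine integral_eq_zero_of_ae ?_
    filter_upwards [Lp.coeFn_zero ℝ 2 (volume.restrict Ω)] with x hx
    rw [hx]
    simp
  rw [h, h, neg_zero]

theorem HasWeakPDeriv.add {Ω : Set Plane} {i : Fin 2} {q q' g g' : L2Scalar Ω}
    (h : HasWeakPDeriv Ω i q g) (h' : HasWeakPDeriv Ω i q' g') :
    HasWeakPDeriv Ω i (q + q') (g + g') := by
  intro φ hφ
  have key (f f' : L2Scalar Ω) (ψ : Plane → ℝ) (hψ : MemLp ψ 2 (volume.restrict Ω)) :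
      ∫ x in Ω, (f + f') x * ψ x = (∫ x in Ω, f x * ψ x) + ∫ x in Ω, f' x * ψ x := by
    rw [← integral_add (integrable_mul_of_memLp (Lp.memLp f) hψ)
      (integrable_mul_of_memLp (Lp.memLp f') hψ)]
    refine integral_congr_ae ?_
    filter_upwards [Lp.coeFn_add f f'] with x hx
    rw [hx]
    simp [add_mul]
  rw [key _ _ _ (hφ.memLp_pderiv i), key _ _ _ hφ.memLp, h φ hφ, h' φ hφ]
  ring

theorem HasWeakPDeriv.const_smul {Ω : Set Plane} {i : Fin 2} {q g : L2Scalar Ω} (c : ℝ)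
    (h : HasWeakPDeriv Ω i q g) : HasWeakPDeriv Ω i (c • q) (c • g) := by
  intro φ hφ
  have key (f : L2Scalar Ω) (ψ : Plane → ℝ) :
      ∫ x in Ω, (c • f) x * ψ x = c * ∫ x in Ω, f x * ψ x := by
    rw [← integral_const_mul]
    refine integral_congr_ae ?_
    filter_upwards [Lp.coeFn_smul c f] with x hx
    rw [hx]
    simp [mul_assoc]
  rw [key, key, h φ hφ]
  ring

theorem eq_of_forall_test {Ω : Set Plane} (hΩ : IsOpen Ω) {w w' : L2Scalar Ω}
    (h : ∀ φ : Plane → ℝ, IsTest Ω φ → ∫ x in Ω, w x * φ x = ∫ x in Ω, w' x * φ x) :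
    w = w' := by
  have hw : MemLp (fun x => w x - w' x) 2 (volume.restrict Ω) := (Lp.memLp w).sub (Lp.memLp w')
  have hloc : LocallyIntegrableOn (fun x => w x - w' x) Ω (volume.restrict Ω) :=
    (hw.locallyIntegrable (by norm_num)).locallyIntegrableOn Ω
  have key := hΩ.ae_eq_zero_of_integral_contDiff_smul_eq_zero (μ := volume.restrict Ω) hloc (by
    intro φ h1 h2 h3
    have hφ : IsTest Ω φ := ⟨h1, h2, h3⟩
    have e := h φ hφ
    rw [← sub_eq_zero, ← integral_sub (integrable_mul_of_memLp (Lp.memLp w) hφ.memLp)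
      (integrable_mul_of_memLp (Lp.memLp w') hφ.memLp)] at e
    rw [← e]
    refine integral_congr_ae (ae_of_all _ fun x => ?_)
    simp only [smul_eq_mul]
    ring)
  refine Lp.ext ?_
  filter_upwards [key, ae_restrict_mem hΩ.measurableSet] with x hx hxΩ
  exact sub_eq_zero.mp (hx hxΩ)

theorem HasWeakRot.unique {Ω : Set Plane} (hΩ : IsOpen Ω) {v : L2Vector Ω} {w w' : L2Scalar Ω}
    (h : HasWeakRot Ω v w) (h' : HasWeakRot Ω v w') : w = w' :=
  eq_of_forall_test hΩ fun φ hφ => (h φ hφ).symm.trans (h' φ hφ)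

theorem HasWeakPDeriv.unique {Ω : Set Plane} (hΩ : IsOpen Ω) {i : Fin 2} {q g g' : L2Scalar Ω}
    (h : HasWeakPDeriv Ω i q g) (h' : HasWeakPDeriv Ω i q g') : g = g' :=
  eq_of_forall_test hΩ fun φ hφ => neg_injective ((h φ hφ).symm.trans (h' φ hφ))

open Classical in
/-- The distributional `rot v` as an element of `L²(Ω)` (zero if there is none). It is unique when
`Ω` is open. -/
def weakRot (Ω : Set Plane) (v : L2Vector Ω) : L2Scalar Ω :=
  if h : ∃ w, HasWeakRot Ω v w then h.choose else 0

open Classical in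
/-- The distributional partial derivative as an element of `L²(Ω)` (zero if there is none). It is
unique when `Ω` is open. -/
def weakPDeriv (Ω : Set Plane) (i : Fin 2) (q : L2Scalar Ω) : L2Scalar Ω :=
  if h : ∃ g, HasWeakPDeriv Ω i q g then h.choose else 0

theorem weakRot_eq {Ω : Set Plane} (hΩ : IsOpen Ω) {v : L2Vector Ω} {w : L2Scalar Ω}
    (h : HasWeakRot Ω v w) : weakRot Ω v = w := by
  have hex : ∃ w, HasWeakRot Ω v w := ⟨w, h⟩
  rw [weakRot, dif_pos hex]
  exact hex.choose_spec.unique hΩ h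

theorem weakPDeriv_eq {Ω : Set Plane} (hΩ : IsOpen Ω) {i : Fin 2} {q g : L2Scalar Ω}
    (h : HasWeakPDeriv Ω i q g) : weakPDeriv Ω i q = g := by
  have hex : ∃ g, HasWeakPDeriv Ω i q g := ⟨g, h⟩
  rw [weakPDeriv, dif_pos hex]
  exact hex.choose_spec.unique hΩ h

/-- `curl q = (∂q/∂y, -∂q/∂x)` with distributional derivatives. -/
def weakCurl (Ω : Set Plane) (q : L2Scalar Ω) (x : Plane) : Plane :=
  !₂[weakPDeriv Ω 1 q x, -weakPDeriv Ω 0 q x]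

/-- `H¹(Ω)`. -/
def H1 (Ω : Set Plane) : Submodule ℝ (L2Scalar Ω) where
  carrier := {q | ∀ i, ∃ g, HasWeakPDeriv Ω i q g}
  zero_mem' := fun _ => ⟨0, HasWeakPDeriv.zero⟩
  add_mem' := by
    intro p q hp hq i
    obtain ⟨g, hg⟩ := hp i
    obtain ⟨g', hg'⟩ := hq i
    exact ⟨g + g', hg.add hg'⟩
  smul_mem' := by
    intro c q hq i
    obtain ⟨g, hg⟩ := hq i
    exact ⟨c • g, hg.const_smul c⟩

/-- `V = H₀(rot; Ω)`, the fields in `L²(Ω)²` with `rot` in `L²(Ω)` and vanishing tangential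
component on the boundary: the closure of the smooth fields with compact support in `Ω`, in the
norm of `H(rot; Ω)`. -/
def H0rot (Ω : Set Plane) : Submodule ℝ (L2Vector Ω) where
  carrier := {v | ∃ w : L2Scalar Ω, HasWeakRot Ω v w ∧
    ∃ Φ : ℕ → Plane → Plane, (∀ n, IsTest Ω (Φ n)) ∧
      Tendsto (fun n => eLpNorm (fun x => v x - Φ n x) 2 (volume.restrict Ω)) atTop (𝓝 0) ∧
      Tendsto (fun n => eLpNorm (fun x => w x - classicalRot (Φ n) x) 2 (volume.restrict Ω))
        atTop (𝓝 0)}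
  zero_mem' := by
    refine ⟨0, HasWeakRot.zero, fun _ => 0, fun _ => IsTest.zero, ?_, ?_⟩
    · refine tendsto_const_nhds.congr fun n => ?_
      rw [eq_comm, eLpNorm_congr_ae (g := 0), eLpNorm_zero]
      filter_upwards [Lp.coeFn_zero Plane 2 (volume.restrict Ω)] with x hx
      rw [hx]
      simp
    · refine tendsto_const_nhds.congr fun n => ?_
      rw [eq_comm, eLpNorm_congr_ae (g := 0), eLpNorm_zero]
      filter_upwards [Lp.coeFn_zero ℝ 2 (volume.restrict Ω)] with x hx
      rw [hx]
      simp [classicalRot, pderiv]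
  add_mem' := by
    rintro v v' ⟨w, hw, Φ, hΦ, h1, h2⟩ ⟨w', hw', Φ', hΦ', h1', h2'⟩
    refine ⟨w + w', hw.add hw', fun n => Φ n + Φ' n, fun n => (hΦ n).add (hΦ' n), ?_, ?_⟩
    · refine tendsto_of_tendsto_of_tendsto_of_le_of_le tendsto_const_nhds
        (by simpa using h1.add h1') (fun _ => zero_le) fun n => ?_
      refine le_trans (le_of_eq (eLpNorm_congr_ae ?_)) (eLpNorm_add_le
        ((Lp.memLp v).sub (hΦ n).memLp).1 ((Lp.memLp v').sub (hΦ' n).memLp).1 (by norm_num))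
      filter_upwards [Lp.coeFn_add v v'] with x hx
      rw [hx]
      simp only [Pi.add_apply]
      abel
    · refine tendsto_of_tendsto_of_tendsto_of_le_of_le tendsto_const_nhds
        (by simpa using h2.add h2') (fun _ => zero_le) fun n => ?_
      refine le_trans (le_of_eq (eLpNorm_congr_ae ?_)) (eLpNorm_add_le
        ((Lp.memLp w).sub (hΦ n).memLp_rot).1 ((Lp.memLp w').sub (hΦ' n).memLp_rot).1
        (by norm_num))
      filter_upwards [Lp.coeFn_add w w'] with x hx
      rw [hx]
      simp only [classicalRot_add (hΦ n) (hΦ' n), Pi.add_apply]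
      abel
  smul_mem' := by
    rintro c v ⟨w, hw, Φ, hΦ, h1, h2⟩
    refine ⟨c • w, hw.const_smul c, fun n => c • Φ n, fun n => (hΦ n).const_smul c, ?_, ?_⟩
    · have := ENNReal.Tendsto.const_mul (a := ‖c‖ₑ) h1 (Or.inr enorm_ne_top)
      rw [mul_zero] at this
      refine this.congr fun n => ?_
      rw [← eLpNorm_const_smul]
      refine eLpNorm_congr_ae ?_
      filter_upwards [Lp.coeFn_smul c v] with x hx
      rw [hx]
      simp only [Pi.smul_apply, smul_sub]
    · have := ENNReal.Tendsto.const_mul (a := ‖c‖ₑ) h2 (Or.inr enorm_ne_top)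
      rw [mul_zero] at this
      refine this.congr fun n => ?_
      rw [← eLpNorm_const_smul]
      refine eLpNorm_congr_ae ?_
      filter_upwards [Lp.coeFn_smul c w] with x hx
      rw [hx]
      simp only [classicalRot_const_smul c (hΦ n), Pi.smul_apply, smul_sub]

/-- `f` is a square integrable function on `Ω` with zero mean. (Integrability is automatic when `Ω`
is bounded.) -/
def MemL2ZeroMean (Ω : Set Plane) (f : Plane → ℝ) : Prop :=
  MemLp f 2 (volume.restrict Ω) ∧ Integrable f (volume.restrict Ω) ∧ ∫ x in Ω, f x = 0

/-- `Q = {q ∈ H¹(Ω) : μ q ∈ L²(Ω) has zero mean}`. -/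
def QSpace (Ω : Set Plane) (μ : Plane → ℝ) : Submodule ℝ (L2Scalar Ω) where
  carrier := {q | q ∈ H1 Ω ∧ MemL2ZeroMean Ω fun x => μ x * q x}
  zero_mem' := by
    have h0 : (fun x => μ x * (0 : L2Scalar Ω) x) =ᵐ[volume.restrict Ω] 0 := by
      filter_upwards [Lp.coeFn_zero ℝ 2 (volume.restrict Ω)] with x hx
      rw [hx]
      simp
    exact ⟨zero_mem _, (memLp_congr_ae h0).mpr MemLp.zero,
      (integrable_congr h0).mpr (integrable_zero _ _ _), integral_eq_zero_of_ae h0⟩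
  add_mem' := by
    rintro p q ⟨hp, hp1, hp2, hp3⟩ ⟨hq, hq1, hq2, hq3⟩
    have h0 : (fun x => μ x * (p + q) x) =ᵐ[volume.restrict Ω]
        (fun x => μ x * p x) + fun x => μ x * q x := by
      filter_upwards [Lp.coeFn_add p q] with x hx
      rw [hx]
      simp [mul_add]
    refine ⟨add_mem hp hq, (memLp_congr_ae h0).mpr (hp1.add hq1),
      (integrable_congr h0).mpr (hp2.add hq2), ?_⟩
    rw [integral_congr_ae h0, integral_add' hp2 hq2, hp3, hq3, add_zero]
  smul_mem' := by
    rintro c q ⟨hq, hq1, hq2, hq3⟩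
    have h0 : (fun x => μ x * (c • q) x) =ᵐ[volume.restrict Ω] c • fun x => μ x * q x := by
      filter_upwards [Lp.coeFn_smul c q] with x hx
      rw [hx]
      simp [mul_left_comm]
    refine ⟨Submodule.smul_mem _ c hq, (memLp_congr_ae h0).mpr (hq1.const_smul c),
      (integrable_congr h0).mpr (hq2.smul c), ?_⟩
    rw [integral_congr_ae h0]
    simp only [Pi.smul_apply, smul_eq_mul]
    rw [integral_const_mul, hq3, mul_zero]

/-- The scalar product `(u, v)_V = (ε u, v) + (μ⁻¹ rot u, rot v)`. -/
def innerV (Ω : Set Plane) (ε μ : Plane → ℝ) (u v : H0rot Ω) : ℝ :=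
  (∫ x in Ω, ε x * inner ℝ (u.1 x) (v.1 x)) +
    ∫ x in Ω, (μ x)⁻¹ * (weakRot Ω u.1 x * weakRot Ω v.1 x)

/-- The scalar product `(p, q)_Q = (ε⁻¹ curl p, curl q)`. -/
def innerQ (Ω : Set Plane) (ε μ : Plane → ℝ) (p q : QSpace Ω μ) : ℝ :=
  ∫ x in Ω, (ε x)⁻¹ * inner ℝ (weakCurl Ω p.1 x) (weakCurl Ω q.1 x)

/-- The norm of `V`, induced by its scalar product. -/
def normV (Ω : Set Plane) (ε μ : Plane → ℝ) (v : H0rot Ω) : ℝ := √(innerV Ω ε μ v v)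

/-- The norm of `Q`, induced by its scalar product. -/
def normQ (Ω : Set Plane) (ε μ : Plane → ℝ) (q : QSpace Ω μ) : ℝ := √(innerQ Ω ε μ q q)

/-- The least-squares form on `V × Q`,
`a(u, p; v, q) = (μ⁻¹ rot u, rot v) + (ε^{1/2} u - ε^{-1/2} curl p, ε^{1/2} v - ε^{-1/2} curl q)`. -/
def lsForm (Ω : Set Plane) (ε μ : Plane → ℝ) (U W : H0rot Ω × QSpace Ω μ) : ℝ :=
  (∫ x in Ω, (μ x)⁻¹ * (weakRot Ω U.1.1 x * weakRot Ω W.1.1 x)) +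
    ∫ x in Ω, inner ℝ
      (√(ε x) • U.1.1 x - (√(ε x))⁻¹ • weakCurl Ω U.2.1 x)
      (√(ε x) • W.1.1 x - (√(ε x))⁻¹ • weakCurl Ω W.2.1 x)

end Maxwell2D

namespace Maxwell2D


/-! Write R = (μ⁻¹ rot v, rot v), V = (εv, v), P = (ε⁻¹ curl q, curl q). Expanding the square, a(v,
q; v, q) = R + V - 2(v, curl q) + P. The mixed term has no sign, but Green's formula
`integral_inner_curl` turns it into 2(rot v, q); no boundary term appears because v is a limit of
compactly supported fields. Young's inequality and the Poincaré inequality `exists_poincare` then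
give 2(rot v, q) ≤ P/2 + K R. Hence R plus the residual controls V + P/2 - K R as well as R, and a
suitable multiple of it controls V + R + P (`coercive_of_mixed_bound`).

The main work is the Poincaré inequality on a domain with possible cracks, whose boundary need not
be Lipschitz. It follows from a bound of the double integral of |q(x) - q(y)|² over Ω × Ω by the
Dirichlet energy: under the constraint ∫ μq = 0, averaging q(x) - q(y) in y with weight μ returns a
multiple of q(x).

The double integral is bounded first on a convex open set, by integrating over translations y = x +
h (`lintegral_increment_le`), and then between any two convex open subsets of Ω, through chains of
overlapping balls (`incrementBound_of_convex`). The lines carrying the boundary segments cut Ω, up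
to a null set, into finitely many convex cells (`exists_convex_cover`), so that finitely many such
bounds add up to one on Ω × Ω. -/

/-! ### The L² norm by duality with test functions. -/

theorem toLp_sq_norm {α : Type*} [MeasurableSpace α] {ν : Measure α} {f : α → ℝ}
    (hf : MemLp f 2 ν) : ‖hf.toLp f‖ ^ 2 = ∫ x, f x ^ 2 ∂ν := by
  rw [← real_inner_self_eq_norm_sq, L2.inner_def]
  refine integral_congr_ae ?_
  filter_upwards [hf.coeFn_toLp] with x hx
  rw [hx]
  simp [sq]

theorem inner_toLp_eq {α : Type*} [MeasurableSpace α] {ν : Measure α} {f g : α → ℝ}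
    (hf : MemLp f 2 ν) (hg : MemLp g 2 ν) :
    inner ℝ (hf.toLp f) (hg.toLp g) = ∫ x, f x * g x ∂ν := by
  rw [L2.inner_def]
  refine integral_congr_ae ?_
  filter_upwards [hf.coeFn_toLp, hg.coeFn_toLp] with x hx hy
  rw [hx, hy]
  simp [mul_comm]

theorem abs_integral_mul_le_sqrt {α : Type*} [MeasurableSpace α] {ν : Measure α} {f g : α → ℝ}
    (hf : MemLp f 2 ν) (hg : MemLp g 2 ν) :
    |∫ x, f x * g x ∂ν| ≤ √(∫ x, f x ^ 2 ∂ν) * √(∫ x, g x ^ 2 ∂ν) := by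
  rw [← inner_toLp_eq hf hg, ← toLp_sq_norm hf, ← toLp_sq_norm hg,
    Real.sqrt_sq (norm_nonneg _), Real.sqrt_sq (norm_nonneg _)]
  exact abs_real_inner_le_norm _ _

/-- The classes of test functions, as a subspace of `L²`. -/
def testSpace (W : Set Plane) : Submodule ℝ (L2Scalar W) where
  carrier := {f | ∃ (φ : Plane → ℝ) (hφ : IsTest W φ), f = hφ.memLp.toLp φ}
  zero_mem' := ⟨0, IsTest.zero, rfl⟩
  add_mem' := by
    rintro _ _ ⟨φ, hφ, rfl⟩ ⟨ψ, hψ, rfl⟩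
    exact ⟨φ + ψ, hφ.add hψ, rfl⟩
  smul_mem' := by
    rintro c _ ⟨φ, hφ, rfl⟩
    exact ⟨c • φ, hφ.const_smul c, rfl⟩

/-- The orthogonal complement is trivial by the fundamental lemma of the calculus of variations,
`eq_of_forall_test`. -/
theorem dense_testSpace {W : Set Plane} (hW : IsOpen W) :
    (testSpace W).topologicalClosure = ⊤ := by
  rw [Submodule.topologicalClosure_eq_top_iff, Submodule.eq_bot_iff]
  intro w hw
  refine eq_of_forall_test hW fun φ hφ => ?_
  have h := (Submodule.mem_orthogonal' _ _).1 hw _ ⟨φ, hφ, rfl⟩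
  have e (f : L2Scalar W) : inner ℝ f (hφ.memLp.toLp φ) = ∫ x in W, f x * φ x := by
    conv_lhs => rw [← Lp.toLp_coeFn f (Lp.memLp f)]
    exact inner_toLp_eq _ _
  rw [← e, ← e, h, inner_zero_left]

/-- Duality turns weak estimates into norm estimates: the bound passes from test functions to all of
L² by density, and is then applied to f itself. -/
theorem integral_sq_le_of_forall_test {W : Set Plane} (hW : IsOpen W) {f : Plane → ℝ}
    (hf : MemLp f 2 (volume.restrict W)) {M : ℝ} (hM : 0 ≤ M)
    (h : ∀ φ : Plane → ℝ, IsTest W φ →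
      |∫ x in W, f x * φ x| ≤ M * √(∫ x in W, φ x ^ 2)) :
    ∫ x in W, f x ^ 2 ≤ M ^ 2 := by
  set F : L2Scalar W := hf.toLp f
  have key : ∀ t : L2Scalar W, |inner ℝ F t| ≤ M * ‖t‖ := by
    intro t
    have ht : t ∈ closure (testSpace W : Set (L2Scalar W)) := by
      rw [← Submodule.topologicalClosure_coe, dense_testSpace hW]
      trivial
    have hcl : IsClosed {t : L2Scalar W | |inner ℝ F t| ≤ M * ‖t‖} :=
      isClosed_le (by fun_prop) (by fun_prop)
    refine closure_minimal ?_ hcl ht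
    rintro _ ⟨φ, hφ, rfl⟩
    have := h φ hφ
    rw [← toLp_sq_norm hφ.memLp, Real.sqrt_sq (norm_nonneg _), ← inner_toLp_eq hf hφ.memLp] at this
    exact this
  have h1 := key F
  rw [real_inner_self_eq_norm_sq, abs_of_nonneg (sq_nonneg _)] at h1
  rw [← toLp_sq_norm hf]
  have h2 : ‖F‖ ≤ M := by
    by_contra! hlt
    nlinarith [norm_nonneg F]
  exact pow_le_pow_left₀ (norm_nonneg _) h2 2

/-! ### Increments of H¹ functions along a translation. -/

theorem IsTest.mono {F : Type*} [NormedAddCommGroup F] [NormedSpace ℝ F] {U Ω : Set Plane}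
    {φ : Plane → F} (hφ : IsTest U φ) (h : U ⊆ Ω) : IsTest Ω φ :=
  ⟨hφ.1, hφ.2.1, hφ.2.2.trans h⟩

theorem IsTest.eq_zero {F : Type*} [NormedAddCommGroup F] [NormedSpace ℝ F] {U : Set Plane}
    {φ : Plane → F} (hφ : IsTest U φ) {x : Plane} (hx : x ∉ U) : φ x = 0 :=
  image_eq_zero_of_notMem_tsupport fun h => hx (hφ.2.2 h)

/-- A test function supported in `U ∩ (U - h)` remains one in `U` when shifted along `h`. -/
theorem IsTest.shift {U : Set Plane} (hU : Convex ℝ U) {h : Plane} {φ : Plane → ℝ}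
    (hφ : IsTest (U ∩ (fun x => x + h) ⁻¹' U) φ) {t : ℝ} (ht : t ∈ Set.Icc (0 : ℝ) 1) :
    IsTest U (fun x => φ (x - t • h)) := by
  refine ⟨hφ.1.comp (contDiff_id.sub contDiff_const), ?_, ?_⟩
  · exact hφ.2.1.comp_homeomorph (Homeomorph.subRight (t • h))
  · intro x hx
    have h1 : x - t • h ∈ tsupport φ :=
      tsupport_comp_subset_preimage (f := fun x : Plane => x - t • h) φ (by fun_prop) hx
    obtain ⟨h2, h3⟩ := hφ.2.2 h1
    -- The point x is the convex combination, with weights 1 - t and t, of x - th and x - th + h,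
    -- both in U.
    have := hU h2 h3 (sub_nonneg.2 ht.2) ht.1 (sub_add_cancel 1 t)
    convert! this using 1
    module

theorem fderiv_apply_eq_pderiv (φ : Plane → ℝ) (x h : Plane) :
    fderiv ℝ φ x h = h 0 * pderiv 0 φ x + h 1 * pderiv 1 φ x := by
  have : h = h 0 • EuclideanSpace.single 0 (1 : ℝ) + h 1 • EuclideanSpace.single 1 (1 : ℝ) := by
    ext i
    fin_cases i <;> simp
  conv_lhs => rw [this]
  simp [pderiv]

theorem integral_shift_sq_le {Ω : Set Plane} {φ : Plane → ℝ} (hφ : Continuous φ)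
    (hc : HasCompactSupport φ) (a : Plane) :
    ∫ x in Ω, φ (x - a) ^ 2 ≤ ∫ x, φ x ^ 2 := by
  have h0 : Integrable fun x => φ x ^ 2 :=
    (hφ.memLp_of_hasCompactSupport (p := 2) (μ := volume) hc).integrable_sq
  calc ∫ x in Ω, φ (x - a) ^ 2 ≤ ∫ x, φ (x - a) ^ 2 :=
        setIntegral_le_integral (h0.comp_sub_right a) (ae_of_all _ fun x => sq_nonneg _)
    _ = ∫ x, φ x ^ 2 := integral_sub_right_eq_self (fun x => φ x ^ 2) a

/-- The squared `L²` norm of the gradient. -/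
def energy (Ω : Set Plane) (q : L2Scalar Ω) : ℝ := ∫ x in Ω, ‖weakCurl Ω q x‖ ^ 2

theorem energy_nonneg (Ω : Set Plane) (q : L2Scalar Ω) : 0 ≤ energy Ω q :=
  integral_nonneg fun _ => sq_nonneg _

theorem memLp_weakCurl (Ω : Set Plane) (q : L2Scalar Ω) :
    MemLp (weakCurl Ω q) 2 (volume.restrict Ω) := by
  rw [memLp_piLp_iff]
  intro i
  fin_cases i
  · exact Lp.memLp (weakPDeriv Ω 1 q)
  · exact (Lp.memLp (weakPDeriv Ω 0 q)).neg

theorem hasWeakPDeriv_weakPDeriv {Ω : Set Plane} {q : L2Scalar Ω} (hq : q ∈ H1 Ω) (i : Fin 2) :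
    HasWeakPDeriv Ω i q (weakPDeriv Ω i q) := by
  rw [weakPDeriv, dif_pos (hq i)]
  exact (hq i).choose_spec

/-- The shift sits on the test function, so differentiation under the integral needs no regularity
of q. Boundedness of Ω makes q integrable, which provides the dominating function. -/
theorem hasDerivAt_integral_shift {Ω : Set Plane} (hb : Bornology.IsBounded Ω) (q : L2Scalar Ω)
    {φ : Plane → ℝ} (hφ : ContDiff ℝ ∞ φ) (hc : HasCompactSupport φ) (h : Plane) (t : ℝ) :
    HasDerivAt (fun t : ℝ => ∫ x in Ω, q x * φ (x - t • h))
      (∫ x in Ω, q x * (fderiv ℝ φ (x - t • h) (-h))) t := by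
  have : IsFiniteMeasure (volume.restrict Ω) := ⟨by simpa using hb.measure_lt_top⟩
  have hq : Integrable q (volume.restrict Ω) := (Lp.memLp q).integrable (by norm_num)
  obtain ⟨C, hC⟩ := hφ.continuous.bounded_above_of_compact_support hc
  have hd : Continuous (fderiv ℝ φ) := hφ.continuous_fderiv (by simp)
  obtain ⟨D, hD⟩ := hd.bounded_above_of_compact_support (hc.fderiv ℝ)
  refine (hasDerivAt_integral_of_dominated_loc_of_deriv_le (s := Set.univ)
    (F := fun (s : ℝ) x => q x * φ (x - s • h))
    (F' := fun (s : ℝ) x => q x * (fderiv ℝ φ (x - s • h) (-h)))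
    (bound := fun x => ‖q x‖ * (D * ‖h‖)) univ_mem ?_ ?_ ?_ ?_ ?_ ?_).2
  · refine Eventually.of_forall fun s => hq.1.mul ?_
    exact (hφ.continuous.comp (by fun_prop)).aestronglyMeasurable
  · refine hq.mul_bdd (c := C) ?_ (ae_of_all _ fun x => hC _)
    exact (hφ.continuous.comp (by fun_prop)).aestronglyMeasurable
  · refine hq.1.mul ?_
    exact ((hd.comp (by fun_prop)).clm_apply continuous_const).aestronglyMeasurable
  · refine ae_of_all _ fun x s _ => ?_
    rw [norm_mul]
    gcongr
    refine (ContinuousLinearMap.le_opNorm _ _).trans ?_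
    rw [norm_neg]
    gcongr
    exact hD _
  · exact hq.norm.mul_const _
  · refine ae_of_all _ fun x s _ => ?_
    have h1 : HasDerivAt (fun s : ℝ => x - s • h) (-h) s := by
      simpa using ((hasDerivAt_id s).smul_const h).const_sub x
    exact (((hφ.differentiable (by simp)) _).hasFDerivAt.comp_hasDerivAt s h1).const_mul _

theorem sq_dot_le (h c : Plane) : (h 1 * c 0 - h 0 * c 1) ^ 2 ≤ ‖h‖ ^ 2 * ‖c‖ ^ 2 := by
  rw [EuclideanSpace.norm_sq_eq, EuclideanSpace.norm_sq_eq]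
  simp only [Fin.sum_univ_two, Real.norm_eq_abs, sq_abs]
  nlinarith [sq_nonneg (h 1 * c 1 + h 0 * c 0)]

/-- Weak form of the increment estimate along a translation. -/
theorem abs_integral_shift_sub_le {Ω U : Set Plane} (hb : Bornology.IsBounded Ω)
    (hU : Convex ℝ U) (hUΩ : U ⊆ Ω) {q : L2Scalar Ω} (hq : q ∈ H1 Ω) {h : Plane} {φ : Plane → ℝ}
    (hφ : IsTest (U ∩ (fun x => x + h) ⁻¹' U) φ) :
    |(∫ x in Ω, q x * φ (x - h)) - ∫ x in Ω, q x * φ x| ≤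
      ‖h‖ * √(energy Ω q) * √(∫ x, φ x ^ 2) := by
  have hder (t : ℝ) := hasDerivAt_integral_shift hb q hφ.1 hφ.2.1 h t
  have hcurl := memLp_weakCurl Ω q
  -- This is h · ∇q, written with the components of curl q.
  set d : Plane → ℝ := fun x => h 1 * weakCurl Ω q x 0 - h 0 * weakCurl Ω q x 1
  have hdm : MemLp d 2 (volume.restrict Ω) := by
    rw [memLp_piLp_iff] at hcurl
    exact ((hcurl 0).const_mul _).sub ((hcurl 1).const_mul _)
  have hd2 : √(∫ x in Ω, d x ^ 2) ≤ ‖h‖ * √(energy Ω q) := by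
    rw [← Real.sqrt_sq (norm_nonneg h), ← Real.sqrt_mul (sq_nonneg _)]
    refine Real.sqrt_le_sqrt ?_
    rw [energy, ← integral_const_mul]
    exact integral_mono hdm.integrable_sq (hcurl.norm.integrable_sq.const_mul _)
      fun x => sq_dot_le _ _
  have hbound : ∀ t ∈ Set.Ico (0 : ℝ) 1,
      ‖∫ x in Ω, q x * (fderiv ℝ φ (x - t • h) (-h))‖ ≤
        ‖h‖ * √(energy Ω q) * √(∫ x, φ x ^ 2) := by
    intro t ht
    -- Convexity of U keeps every intermediate shift supported in Ω, so the weak derivatives of q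
    -- may be tested with it.
    have hψ : IsTest Ω (fun x => φ (x - t • h)) := (hφ.shift hU ⟨ht.1, ht.2.le⟩).mono hUΩ
    have hqm := Lp.memLp q
    have hp (i : Fin 2) : ∫ x in Ω, q x * pderiv i (fun x => φ (x - t • h)) x =
        -∫ x in Ω, weakPDeriv Ω i q x * φ (x - t • h) := hasWeakPDeriv_weakPDeriv hq i _ hψ
    have e : ∫ x in Ω, q x * (fderiv ℝ φ (x - t • h) (-h)) =
        ∫ x in Ω, d x * φ (x - t • h) := by
      calc ∫ x in Ω, q x * (fderiv ℝ φ (x - t • h) (-h))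
          = ∫ x in Ω, ((-h 0) * (q x * pderiv 0 (fun x => φ (x - t • h)) x) +
            (-h 1) * (q x * pderiv 1 (fun x => φ (x - t • h)) x)) := by
            refine integral_congr_ae (ae_of_all _ fun x => ?_)
            simp only [fderiv_apply_eq_pderiv]
            simp only [pderiv, fderiv_comp_sub, PiLp.neg_apply]
            ring
        _ = ∫ x in Ω, ((h 0) * (weakPDeriv Ω 0 q x * φ (x - t • h)) +
              (h 1) * (weakPDeriv Ω 1 q x * φ (x - t • h))) := by
            rw [integral_add, integral_add, integral_const_mul, integral_const_mul,
              integral_const_mul, integral_const_mul, hp, hp]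
            · ring
            · exact (integrable_mul_of_memLp (Lp.memLp _) hψ.memLp).const_mul _
            · exact (integrable_mul_of_memLp (Lp.memLp _) hψ.memLp).const_mul _
            · exact (integrable_mul_of_memLp hqm (hψ.memLp_pderiv 0)).const_mul _
            · exact (integrable_mul_of_memLp hqm (hψ.memLp_pderiv 1)).const_mul _
        _ = _ := by
            refine integral_congr_ae (ae_of_all _ fun x => ?_)
            simp [d, weakCurl]
            ring
    rw [e, Real.norm_eq_abs]
    refine (abs_integral_mul_le_sqrt hdm hψ.memLp).trans ?_
    gcongr
    exact integral_shift_sq_le hφ.1.continuous hφ.2.1 _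
  -- Mean value inequality in t, between the unshifted and the fully shifted test function.
  have := norm_image_sub_le_of_norm_deriv_le_segment_01'
    (fun t _ => (hder t).hasDerivWithinAt) hbound
  simpa using this


theorem lintegral_enorm_sq_eq {α : Type*} [MeasurableSpace α] {ν : Measure α} {f : α → ℝ}
    (hf : MemLp f 2 ν) : ∫⁻ x, ‖f x‖ₑ ^ 2 ∂ν = ENNReal.ofReal (∫ x, f x ^ 2 ∂ν) := by
  rw [ofReal_integral_eq_lintegral_ofReal hf.integrable_sq (ae_of_all _ fun x => sq_nonneg _)]
  refine lintegral_congr fun x => ?_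
  rw [← sq_abs, ENNReal.ofReal_pow (abs_nonneg _), Real.enorm_eq_ofReal_abs]

theorem measurable_coeFn {Ω : Set Plane} (q : L2Scalar Ω) : Measurable q :=
  (Lp.stronglyMeasurable q).measurable

theorem measurable_increment {Ω : Set Plane} (q : L2Scalar Ω) :
    Measurable fun z : Plane × Plane => ‖q z.1 - q z.2‖ₑ ^ 2 := by
  have := measurable_coeFn q
  fun_prop

/-- Increment estimate along a translation inside a convex set. -/
theorem lintegral_increment_le {Ω U : Set Plane} (hb : Bornology.IsBounded Ω)
    (hUo : IsOpen U) (hU : Convex ℝ U) (hUΩ : U ⊆ Ω) {q : L2Scalar Ω} (hq : q ∈ H1 Ω) (h : Plane) :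
    ∫⁻ x in U ∩ (fun x => x + h) ⁻¹' U, ‖q x - q (x + h)‖ₑ ^ 2 ≤
      ENNReal.ofReal (‖h‖ ^ 2 * energy Ω q) := by
  set W := U ∩ (fun x => x + h) ⁻¹' U
  have hWo : IsOpen W := hUo.inter (hUo.preimage (by fun_prop))
  have hqU : MemLp q 2 (volume.restrict U) :=
    (Lp.memLp q).mono_measure (Measure.restrict_mono hUΩ le_rfl)
  have h1 : MemLp q 2 (volume.restrict W) :=
    hqU.mono_measure (Measure.restrict_mono Set.inter_subset_left le_rfl)
  have h2 : MemLp (fun x => q (x + h)) 2 (volume.restrict W) := by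
    have hm : MeasurePreserving (fun x : Plane => x + h)
        (volume.restrict ((fun x => x + h) ⁻¹' U)) (volume.restrict U) :=
      (measurePreserving_add_right volume h).restrict_preimage hUo.measurableSet
    exact (hqU.comp_measurePreserving hm).mono_measure
      (Measure.restrict_mono Set.inter_subset_right le_rfl)
  refine (lintegral_enorm_sq_eq (h1.sub h2)).trans_le ?_
  refine ENNReal.ofReal_le_ofReal ?_
  -- By duality it suffices to test the increment with φ supported in W; a change of variables then
  -- moves the shift onto φ.
  have hM : 0 ≤ ‖h‖ * √(energy Ω q) := by positivity
  refine (integral_sq_le_of_forall_test hWo (h1.sub h2) hM ?_).trans_eq ?_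
  · intro φ hφ
    have i1 : Integrable (fun x => q x * φ x) (volume.restrict W) :=
      integrable_mul_of_memLp h1 hφ.memLp
    have i2 : Integrable (fun x => q (x + h) * φ x) (volume.restrict W) :=
      integrable_mul_of_memLp h2 hφ.memLp
    have e1 : ∫ x in W, q x * φ x = ∫ x in Ω, q x * φ x := by
      rw [setIntegral_eq_integral_of_forall_compl_eq_zero fun x hx => by rw [hφ.eq_zero hx, mul_zero],
        setIntegral_eq_integral_of_forall_compl_eq_zero fun x hx => by
          rw [hφ.eq_zero fun hxW => hx (hUΩ hxW.1), mul_zero]]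
    -- Substitute x - h for x. If x - h lies in W then x lies in U, so the shifted φ vanishes
    -- outside Ω.
    have e2 : ∫ x in W, q (x + h) * φ x = ∫ x in Ω, q x * φ (x - h) := by
      rw [setIntegral_eq_integral_of_forall_compl_eq_zero fun x hx => by rw [hφ.eq_zero hx, mul_zero],
        setIntegral_eq_integral_of_forall_compl_eq_zero,
        ← integral_sub_right_eq_self (fun x => q (x + h) * φ x) h]
      · simp
      · intro x hx
        rw [hφ.eq_zero fun hxW => hx (hUΩ ?_), mul_zero]
        simpa using hxW.2
    have e3 : ∫ x in W, φ x ^ 2 = ∫ x, φ x ^ 2 :=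
      setIntegral_eq_integral_of_forall_compl_eq_zero fun x hx => by rw [hφ.eq_zero hx]; simp
    have e4 : ∫ x in W, (q x - q (x + h)) * φ x =
        -((∫ x in Ω, q x * φ (x - h)) - ∫ x in Ω, q x * φ x) := by
      rw [← e1, ← e2, neg_sub, ← integral_sub i1 i2]
      simp only [sub_mul]
    calc _ = |∫ x in W, (q x - q (x + h)) * φ x| := rfl
      _ ≤ _ := by
        rw [e4, e3, abs_neg]
        exact abs_integral_shift_sub_le hb hU hUΩ hq hφ
  · rw [mul_pow, Real.sq_sqrt (energy_nonneg Ω q)]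

/-! ### Mean square increments between subsets of the domain. -/

/-- The mean square increment between `U` and `V` is controlled by the gradient on `Ω`. -/
def IncrementBound (Ω U V : Set Plane) : Prop :=
  ∃ C : ENNReal, C ≠ ⊤ ∧ ∀ q ∈ H1 Ω,
    ∫⁻ x in U, ∫⁻ y in V, ‖q x - q y‖ₑ ^ 2 ≤ C * ENNReal.ofReal (energy Ω q)

theorem IncrementBound.mono {Ω U V U' V' : Set Plane} (h : IncrementBound Ω U V) (hU : U' ⊆ U)
    (hV : V' ⊆ V) : IncrementBound Ω U' V' := by
  obtain ⟨C, hC, h⟩ := h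
  refine ⟨C, hC, fun q hq => le_trans ?_ (h q hq)⟩
  exact (lintegral_mono_set hU).trans (lintegral_mono fun x => lintegral_mono_set hV)

theorem IncrementBound.symm {Ω U V : Set Plane} (h : IncrementBound Ω U V) :
    IncrementBound Ω V U := by
  obtain ⟨C, hC, h⟩ := h
  refine ⟨C, hC, fun q hq => le_trans (le_of_eq ?_) (h q hq)⟩
  rw [lintegral_lintegral_swap]
  · simp only [enorm_sub_rev]
  · exact (measurable_increment q).aemeasurable

theorem IncrementBound.congr_ae {Ω U V U' V' : Set Plane} (h : IncrementBound Ω U V)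
    (hU : U' ≤ᵐ[volume] U) (hV : V' ≤ᵐ[volume] V) : IncrementBound Ω U' V' := by
  obtain ⟨C, hC, h⟩ := h
  refine ⟨C, hC, fun q hq => le_trans ?_ (h q hq)⟩
  exact (lintegral_mono' (Measure.restrict_mono_ae hU) le_rfl).trans
    (lintegral_mono fun x => lintegral_mono' (Measure.restrict_mono_ae hV) le_rfl)

theorem IncrementBound.biUnion_left {Ω V : Set Plane} {ι : Type*} (s : Finset ι)
    {U : ι → Set Plane} (h : ∀ i ∈ s, IncrementBound Ω (U i) V) :
    IncrementBound Ω (⋃ i ∈ s, U i) V := by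
  classical
  induction s using Finset.induction_on with
  | empty => exact ⟨0, by simp, by simp⟩
  | insert a s _ ih =>
    obtain ⟨C, hC, h1⟩ := h a (Finset.mem_insert_self a s)
    obtain ⟨D, hD, h2⟩ := ih fun i hi => h i (Finset.mem_insert_of_mem hi)
    refine ⟨C + D, by simp [hC, hD], fun q hq => ?_⟩
    rw [Finset.set_biUnion_insert, add_mul]
    exact (lintegral_union_le _ _ _).trans (add_le_add (h1 q hq) (h2 q hq))

theorem enorm_sub_sq_le (a b c : ℝ) : ‖a - c‖ₑ ^ 2 ≤ 2 * ‖a - b‖ₑ ^ 2 + 2 * ‖b - c‖ₑ ^ 2 := by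
  have e (x : ℝ) : ‖x‖ₑ ^ 2 = ENNReal.ofReal (x ^ 2) := by
    rw [← sq_abs, ENNReal.ofReal_pow (abs_nonneg _), Real.enorm_eq_ofReal_abs]
  have e2 : (2 : ENNReal) = ENNReal.ofReal 2 := by simp
  rw [e, e, e, e2, ← ENNReal.ofReal_mul (by norm_num), ← ENNReal.ofReal_mul (by norm_num),
    ← ENNReal.ofReal_add (by positivity) (by positivity)]
  refine ENNReal.ofReal_le_ofReal ?_
  nlinarith [sq_nonneg (a - b - (b - c))]

/-- Insert an intermediate point y in V, use |a - c|² ≤ 2|a - b|² + 2|b - c|² and average over y.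
The average requires V to have positive finite measure. -/
theorem IncrementBound.trans {Ω U V W : Set Plane} (h : IncrementBound Ω U V)
    (h' : IncrementBound Ω V W) (hV0 : volume V ≠ 0) (hV : volume V ≠ ⊤) (hU : volume U ≠ ⊤)
    (hW : volume W ≠ ⊤) : IncrementBound Ω U W := by
  obtain ⟨C, hC, h1⟩ := h
  obtain ⟨D, hD, h2⟩ := h'.symm
  refine ⟨(volume V)⁻¹ * (2 * volume W * C + 2 * volume U * D), by finiteness, fun q hq => ?_⟩
  have hqm := measurable_coeFn q
  have key : volume V * ∫⁻ x in U, ∫⁻ z in W, ‖q x - q z‖ₑ ^ 2 ≤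
      2 * volume W * (∫⁻ x in U, ∫⁻ y in V, ‖q x - q y‖ₑ ^ 2) +
      2 * volume U * (∫⁻ z in W, ∫⁻ y in V, ‖q z - q y‖ₑ ^ 2) := by
    calc volume V * ∫⁻ x in U, ∫⁻ z in W, ‖q x - q z‖ₑ ^ 2
        = ∫⁻ x in U, ∫⁻ z in W, ∫⁻ _ in V, ‖q x - q z‖ₑ ^ 2 := by
          simp only [lintegral_const, Measure.restrict_apply_univ]
          rw [← lintegral_const_mul' _ _ hV]
          refine lintegral_congr fun x => ?_
          rw [← lintegral_const_mul' _ _ hV]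
          simp only [mul_comm]
      _ ≤ ∫⁻ x in U, ∫⁻ z in W, ∫⁻ y in V,
            (2 * ‖q x - q y‖ₑ ^ 2 + 2 * ‖q z - q y‖ₑ ^ 2) := by
          refine lintegral_mono fun x => lintegral_mono fun z => lintegral_mono fun y => ?_
          simp only
          rw [enorm_sub_rev (q z)]
          exact enorm_sub_sq_le _ _ _
      _ = ∫⁻ x in U, ((2 * ∫⁻ y in V, ‖q x - q y‖ₑ ^ 2) * volume W +
            2 * ∫⁻ z in W, ∫⁻ y in V, ‖q z - q y‖ₑ ^ 2) := by
          refine lintegral_congr fun x => ?_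
          rw [← lintegral_const_mul' _ _ (by simp)]
          rw [← Measure.restrict_apply_univ (s := W), ← lintegral_const,
            ← lintegral_const_mul' _ _ (by simp),
            ← lintegral_add_left (by fun_prop)]
          refine lintegral_congr fun z => ?_
          rw [← lintegral_const_mul' _ _ (by simp), ← lintegral_add_left (by fun_prop)]
      _ = _ := by
          rw [lintegral_add_right _ (by fun_prop), lintegral_const, Measure.restrict_apply_univ,
            lintegral_mul_const' _ _ hW, lintegral_const_mul' _ _ (by simp)]
          ring
  calc ∫⁻ x in U, ∫⁻ z in W, ‖q x - q z‖ₑ ^ 2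
      = (volume V)⁻¹ * (volume V * ∫⁻ x in U, ∫⁻ z in W, ‖q x - q z‖ₑ ^ 2) := by
        rw [← mul_assoc, ENNReal.inv_mul_cancel hV0 hV, one_mul]
    _ ≤ (volume V)⁻¹ * (2 * volume W * (C * ENNReal.ofReal (energy Ω q)) +
          2 * volume U * (D * ENNReal.ofReal (energy Ω q))) := by
        gcongr
        refine key.trans ?_
        gcongr
        · exact h1 q hq
        · exact h2 q hq
    _ = _ := by ring

/-- Substituting y = x + h and exchanging the integrals leaves, for each h, an increment along a
fixed translation. Only |h| ≤ 2R contributes, where R bounds the norm on U; this gives the constant.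
-/
theorem incrementBound_self_of_convex {Ω U : Set Plane} (hb : Bornology.IsBounded Ω)
    (hUo : IsOpen U) (hU : Convex ℝ U) (hUΩ : U ⊆ Ω) : IncrementBound Ω U U := by
  obtain ⟨R, hR⟩ := (hb.subset hUΩ).exists_norm_le
  have hUm := hUo.measurableSet
  refine ⟨volume (Metric.closedBall (0 : Plane) (2 * R)) * ENNReal.ofReal ((2 * R) ^ 2),
    ENNReal.mul_ne_top measure_closedBall_lt_top.ne ENNReal.ofReal_ne_top, fun q hq => ?_⟩
  have hqm := measurable_coeFn q
  set G : Plane → Plane → ENNReal := fun x h =>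
    (U ∩ (fun x => x + h) ⁻¹' U).indicator (fun x => ‖q x - q (x + h)‖ₑ ^ 2) x
  have hGm : Measurable (Function.uncurry G) := by
    have hs : MeasurableSet {z : Plane × Plane | z.1 ∈ U ∧ z.1 + z.2 ∈ U} :=
      (measurable_fst hUm).inter ((measurable_fst.add measurable_snd) hUm)
    have : Function.uncurry G = {z : Plane × Plane | z.1 ∈ U ∧ z.1 + z.2 ∈ U}.indicator
        (fun z => ‖q z.1 - q (z.1 + z.2)‖ₑ ^ 2) := by
      funext z
      simp only [G, Function.uncurry, Set.indicator]
      rfl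
    rw [this]
    refine Measurable.indicator ?_ hs
    fun_prop
  calc ∫⁻ x in U, ∫⁻ y in U, ‖q x - q y‖ₑ ^ 2
      = ∫⁻ x, ∫⁻ h, G x h := by
        rw [← lintegral_indicator hUm]
        refine lintegral_congr fun x => ?_
        by_cases hx : x ∈ U
        · rw [Set.indicator_of_mem hx, ← lintegral_indicator hUm,
            ← lintegral_add_left_eq_self _ x]
          refine lintegral_congr fun h => ?_
          by_cases hxh : x + h ∈ U
          · rw [Set.indicator_of_mem hxh]
            have hn : x ∈ U ∩ (fun x => x + h) ⁻¹' U := ⟨hx, hxh⟩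
            simp only [G]
            rw [Set.indicator_of_mem hn]
          · rw [Set.indicator_of_notMem hxh]
            have hn : x ∉ U ∩ (fun x => x + h) ⁻¹' U := fun hn => hxh hn.2
            simp only [G]
            rw [Set.indicator_of_notMem hn]
        · rw [Set.indicator_of_notMem hx]
          simp [G, Set.indicator, hx]
    _ = ∫⁻ h, ∫⁻ x, G x h := lintegral_lintegral_swap hGm.aemeasurable
    _ ≤ ∫⁻ h, (Metric.closedBall (0 : Plane) (2 * R)).indicator
          (fun _ => ENNReal.ofReal ((2 * R) ^ 2) * ENNReal.ofReal (energy Ω q)) h := by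
        refine lintegral_mono fun h => ?_
        simp only [G]
        rw [lintegral_indicator (hUm.inter ((measurable_add_const h) hUm))]
        by_cases hh : h ∈ Metric.closedBall (0 : Plane) (2 * R)
        · rw [Set.indicator_of_mem hh, ← ENNReal.ofReal_mul (sq_nonneg _)]
          refine (lintegral_increment_le hb hUo hU hUΩ hq h).trans (ENNReal.ofReal_le_ofReal ?_)
          rw [mem_closedBall_zero_iff] at hh
          have := energy_nonneg Ω q
          gcongr
        · have : U ∩ (fun x => x + h) ⁻¹' U = ∅ := by
            rw [Set.eq_empty_iff_forall_notMem]
            rintro x ⟨h1, h2⟩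
            refine hh ?_
            rw [mem_closedBall_zero_iff]
            calc ‖h‖ = ‖(x + h) - x‖ := by simp
              _ ≤ ‖x + h‖ + ‖x‖ := norm_sub_le _ _
              _ ≤ 2 * R := by linarith [hR _ h1, hR _ h2]
          simp [this]
    _ = _ := by
        rw [lintegral_indicator measurableSet_closedBall, lintegral_const,
          Measure.restrict_apply_univ]
        ring

/-- The nonempty open intersection has positive measure and serves as the intermediate set. -/
theorem incrementBound_of_convex_of_inter {Ω U V : Set Plane} (hb : Bornology.IsBounded Ω)
    (hUo : IsOpen U) (hU : Convex ℝ U) (hUΩ : U ⊆ Ω) (hVo : IsOpen V) (hV : Convex ℝ V)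
    (hVΩ : V ⊆ Ω) (hne : (U ∩ V).Nonempty) : IncrementBound Ω U V := by
  have fin {S : Set Plane} (hS : S ⊆ Ω) : volume S ≠ ⊤ := (hb.subset hS).measure_lt_top.ne
  refine IncrementBound.trans (V := U ∩ V)
    ((incrementBound_self_of_convex hb hUo hU hUΩ).mono le_rfl Set.inter_subset_left)
    ((incrementBound_self_of_convex hb hVo hV hVΩ).mono Set.inter_subset_right le_rfl)
    ((hUo.inter hVo).measure_pos _ hne).ne' (fin (Set.inter_subset_left.trans hUΩ))
    (fin hUΩ) (fin hVΩ)

/-- Having an increment bound between small balls about two points is a symmetric and transitive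
relation on Ω that holds for nearby points, so connectedness extends it to all pairs. U and V are
then linked through a ball centred in each. -/
theorem incrementBound_of_convex {Ω U V : Set Plane} (hb : Bornology.IsBounded Ω)
    (hΩo : IsOpen Ω) (hΩc : IsPreconnected Ω)
    (hUo : IsOpen U) (hU : Convex ℝ U) (hUΩ : U ⊆ Ω) (hVo : IsOpen V) (hV : Convex ℝ V)
    (hVΩ : V ⊆ Ω) : IncrementBound Ω U V := by
  have fin {S : Set Plane} (hS : S ⊆ Ω) : volume S ≠ ⊤ := (hb.subset hS).measure_lt_top.ne
  rcases U.eq_empty_or_nonempty with rfl | ⟨x, hx⟩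
  · exact ⟨0, by simp, by simp⟩
  rcases V.eq_empty_or_nonempty with rfl | ⟨y, hy⟩
  · exact ⟨0, by simp, by simp⟩
  -- The radius is chosen for every point of the plane so that the relation below is defined
  -- everywhere; its value 0 outside Ω plays no role.
  have hball : ∀ x, ∃ r, x ∈ Ω → 0 < r ∧ Metric.ball x r ⊆ Ω := fun x => by
    by_cases hx : x ∈ Ω
    · obtain ⟨r, hr, h⟩ := Metric.isOpen_iff.1 hΩo x hx
      exact ⟨r, fun _ => ⟨hr, h⟩⟩
    · exact ⟨0, fun h => absurd h hx⟩
  choose r hr using hball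
  have hpos {x : Plane} (hx : x ∈ Ω) : volume (Metric.ball x (r x)) ≠ 0 :=
    (Metric.measure_ball_pos volume x (hr x hx).1).ne'
  have key : IncrementBound Ω (Metric.ball x (r x)) (Metric.ball y (r y)) := by
    refine hΩc.induction₂ (fun x y => IncrementBound Ω (Metric.ball x (r x)) (Metric.ball y (r y)))
      ?_ ?_ ?_ (hUΩ hx) (hVΩ hy)
    · intro x hx
      filter_upwards [self_mem_nhdsWithin,
        mem_nhdsWithin_of_mem_nhds (Metric.ball_mem_nhds x (hr x hx).1)] with y hy hyb
      exact incrementBound_of_convex_of_inter hb Metric.isOpen_ball (convex_ball _ _) (hr x hx).2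
        Metric.isOpen_ball (convex_ball _ _) (hr y hy).2
        ⟨y, hyb, Metric.mem_ball_self (hr y hy).1⟩
    · intro x y z hx hy hz h1 h2
      exact h1.trans h2 (hpos hy) (fin (hr y hy).2) (fin (hr x hx).2) (fin (hr z hz).2)
    · intro x y hx hy h
      exact h.symm
  have h1 := incrementBound_of_convex_of_inter hb hUo hU hUΩ Metric.isOpen_ball
    (convex_ball x (r x)) (hr x (hUΩ hx)).2 ⟨x, hx, Metric.mem_ball_self (hr x (hUΩ hx)).1⟩
  have h2 := incrementBound_of_convex_of_inter hb Metric.isOpen_ball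
    (convex_ball y (r y)) (hr y (hVΩ hy)).2 hVo hV hVΩ
    ⟨y, Metric.mem_ball_self (hr y (hVΩ hy)).1, hy⟩
  exact (h1.trans key (hpos (hUΩ hx)) (fin (hr x (hUΩ hx)).2) (fin hUΩ)
    (fin (hr y (hVΩ hy)).2)).trans h2 (hpos (hVΩ hy)) (fin (hr y (hVΩ hy)).2) (fin hUΩ) (fin hVΩ)


/-! ### Decomposition of a polygonal domain into convex cells. -/

/-- An affine function vanishing exactly on the line through the end points of `s`. -/
def lineSide (s : Plane × Plane) (x : Plane) : ℝ :=
  inner ℝ (!₂[-(s.2 - s.1) 1, (s.2 - s.1) 0] : Plane) (x - s.1)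

theorem continuous_lineSide (s : Plane × Plane) : Continuous (lineSide s) := by
  unfold lineSide
  fun_prop

theorem lineSide_combo (s : Plane × Plane) (x y : Plane) {a b : ℝ} (hab : a + b = 1) :
    lineSide s (a • x + b • y) = a * lineSide s x + b * lineSide s y := by
  have : a • x + b • y - s.1 = a • (x - s.1) + b • (y - s.1) := by
    have hb : b = 1 - a := by linarith
    subst hb
    module
  rw [lineSide, this, inner_add_right, real_inner_smul_right, real_inner_smul_right]
  rfl

theorem lineSide_eq_zero {s : Plane × Plane} {x : Plane} (hx : x ∈ segment ℝ s.1 s.2) :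
    lineSide s x = 0 := by
  obtain ⟨a, b, -, -, hab, rfl⟩ := hx
  rw [lineSide_combo s _ _ hab]
  simp [lineSide, PiLp.inner_apply, Fin.sum_univ_two]
  right
  ring

/-- The zero set is a translate of the orthogonal complement of a nonzero normal, hence of a proper
subspace. -/
theorem volume_lineSide_eq_zero {s : Plane × Plane} (hs : s.1 ≠ s.2) :
    volume {x | lineSide s x = 0} = 0 := by
  set n : Plane := !₂[-(s.2 - s.1) 1, (s.2 - s.1) 0]
  have hn0 : n ≠ 0 := by
    intro h
    refine hs ?_
    have h0 := congrArg (fun v : Plane => v 0) h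
    have h1 := congrArg (fun v : Plane => v 1) h
    simp [n, sub_eq_zero] at h0 h1
    ext i
    fin_cases i
    · exact h1.symm
    · simp only [Fin.mk_one]
      linarith
  have e : {x | lineSide s x = 0} =
      (fun x => x + -s.1) ⁻¹' ((ℝ ∙ n)ᗮ : Submodule ℝ Plane) := by
    ext x
    simp only [Set.mem_ofPred_eq, Set.mem_preimage, SetLike.mem_coe,
      Submodule.mem_orthogonal_singleton_iff_inner_right, ← sub_eq_add_neg]
    rfl
  rw [e, measure_preimage_add_right]
  refine Measure.addHaar_submodule volume _ fun htop => hn0 ?_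
  have : n ∈ (ℝ ∙ n)ᗮ := htop ▸ Submodule.mem_top
  rwa [Submodule.mem_orthogonal_singleton_iff_inner_right, inner_self_eq_zero] at this

open Classical in
/-- The cell of the line arrangement of `S` that is on the positive side of the lines in `t` and on
the negative side of the others. -/
def cell (S t : Finset (Plane × Plane)) : Set Plane :=
  {x | ∀ s ∈ S, if s ∈ t then 0 < lineSide s x else lineSide s x < 0}

theorem isOpen_cell (S t : Finset (Plane × Plane)) : IsOpen (cell S t) := by
  have : cell S t = ⋂ s ∈ S, {x | s ∈ t ∧ 0 < lineSide s x ∨ s ∉ t ∧ lineSide s x < 0} := by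
    ext x
    simp only [cell, Set.mem_ofPred_eq, Set.mem_iInter]
    refine forall₂_congr fun s _ => ?_
    split_ifs with h <;> simp [h]
  rw [this]
  refine isOpen_biInter_finset fun s _ => ?_
  by_cases h : s ∈ t
  · simpa [h] using isOpen_lt continuous_const (continuous_lineSide s)
  · simpa [h] using isOpen_lt (continuous_lineSide s) continuous_const

theorem convex_cell (S t : Finset (Plane × Plane)) : Convex ℝ (cell S t) := by
  intro x hx y hy a b ha hb hab s hs
  have h1 := hx s hs
  have h2 := hy s hs
  rw [lineSide_combo s _ _ hab]
  -- Strictness of the inequalities needs a positive weight, so a = 0 is treated apart.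
  rcases ha.eq_or_lt with rfl | ha
  · obtain rfl : b = 1 := by linarith
    simpa using h2
  split_ifs at h1 h2 ⊢ with h
  · have := mul_pos ha h1
    have := mul_nonneg hb h2.le
    linarith
  · have := mul_neg_of_pos_of_neg ha h1
    have := mul_nonpos_of_nonneg_of_nonpos hb h2.le
    linarith

/-- Off the frontier, K is covered by the disjoint open sets Ω and the complement of its closure. -/
theorem subset_of_isPreconnected_of_disjoint_frontier {X : Type*} [TopologicalSpace X]
    {Ω K : Set X} (hΩ : IsOpen Ω) (hK : IsPreconnected K) (hd : Disjoint K (frontier Ω))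
    (hne : (K ∩ Ω).Nonempty) : K ⊆ Ω := by
  refine hK.subset_left_of_subset_union hΩ isClosed_closure.isOpen_compl
    (disjoint_compl_right.mono_left subset_closure) ?_ hne
  intro x hx
  by_contra hn
  simp only [Set.mem_union, not_or, Set.mem_compl_iff, not_not] at hn
  exact hd.notMem_of_mem_left hx (hΩ.frontier_eq ▸ ⟨hn.2, hn.1⟩)

/-- A polygonal domain is, up to a null set, a finite union of open convex sets. -/
theorem IsPolygonalDomain.exists_convex_cover {Ω : Set Plane} (hΩ : IsPolygonalDomain Ω) :
    ∃ (T : Finset (Finset (Plane × Plane))) (U : Finset (Plane × Plane) → Set Plane),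
      (∀ t ∈ T, IsOpen (U t) ∧ Convex ℝ (U t) ∧ U t ⊆ Ω) ∧ Ω ≤ᵐ[volume] ⋃ t ∈ T, U t := by
  classical
  obtain ⟨S, hS, hfr⟩ := hΩ.boundary
  refine ⟨S.powerset.filter fun t => cell S t ⊆ Ω, cell S,
    fun t ht => ⟨isOpen_cell S t, convex_cell S t, (Finset.mem_filter.1 ht).2⟩, ?_⟩
  have hae : ∀ᵐ x ∂(volume : Measure Plane), ∀ s ∈ S, lineSide s x ≠ 0 := by
    rw [Finset.eventually_all]
    exact fun s hs => by simpa [ae_iff] using volume_lineSide_eq_zero (hS s hs)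
  filter_upwards [hae] with x hx hxΩ
  -- Off the lines, the signs of x determine the cell containing it. That cell avoids the frontier
  -- of Ω, since `lineSide` vanishes on each boundary segment, and so it lies entirely in Ω.
  set t := S.filter fun s => 0 < lineSide s x
  have hxt : x ∈ cell S t := by
    intro s hs
    by_cases h : 0 < lineSide s x
    · simp [t, hs, h]
    · simp only [t, Finset.mem_filter, hs, h, and_false, if_false]
      exact lt_of_le_of_ne (not_lt.1 h) (hx s hs)
  refine Set.mem_biUnion (x := t) ?_ hxt
  refine Finset.mem_filter.2 ⟨Finset.mem_powerset.2 (Finset.filter_subset _ _), ?_⟩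
  refine subset_of_isPreconnected_of_disjoint_frontier hΩ.isOpen (convex_cell S t).isPreconnected
    ?_ ⟨x, hxt, hxΩ⟩
  rw [Set.disjoint_left]
  intro y hy hyf
  rw [hfr] at hyf
  obtain ⟨s, hs, hys⟩ := Set.mem_iUnion₂.1 hyf
  have h1 := hy s hs
  rw [lineSide_eq_zero hys] at h1
  split_ifs at h1 <;> exact lt_irrefl _ h1

/-- Products of cells cover Ω × Ω up to a null set, and the constants of the finitely many pairs add
up. -/
theorem IsPolygonalDomain.incrementBound {Ω : Set Plane} (hΩ : IsPolygonalDomain Ω) :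
    IncrementBound Ω Ω Ω := by
  obtain ⟨T, U, hU, hcov⟩ := hΩ.exists_convex_cover
  refine IncrementBound.congr_ae ?_ hcov hcov
  refine IncrementBound.biUnion_left T fun t ht => IncrementBound.symm ?_
  refine IncrementBound.biUnion_left T fun t' ht' => ?_
  exact incrementBound_of_convex hΩ.isBounded hΩ.isOpen hΩ.isConnected.isPreconnected
    (hU t' ht').1 (hU t' ht').2.1 (hU t' ht').2.2 (hU t ht).1 (hU t ht).2.1 (hU t ht).2.2

/-! ### The weighted Poincaré inequality. -/

theorem IsAdmissibleCoeff.memLp {Ω : Set Plane} (hb : Bornology.IsBounded Ω) {c : Plane → ℝ}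
    (hc : IsAdmissibleCoeff Ω c) : MemLp c 2 (volume.restrict Ω) := by
  have : IsFiniteMeasure (volume.restrict Ω) := ⟨by simpa using hb.measure_lt_top⟩
  obtain ⟨lo, hi, hlo, h⟩ := hc.bounds
  refine MemLp.of_bound hc.aemeasurable.aestronglyMeasurable hi ?_
  filter_upwards [h] with x hx
  rw [Real.norm_eq_abs, abs_of_nonneg (hlo.le.trans hx.1)]
  exact hx.2

theorem IsAdmissibleCoeff.integral_pos {Ω : Set Plane} (hΩ : IsPolygonalDomain Ω) {c : Plane → ℝ}
    (hc : IsAdmissibleCoeff Ω c) : 0 < ∫ x in Ω, c x := by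
  have hb := hΩ.isBounded
  have : IsFiniteMeasure (volume.restrict Ω) := ⟨by simpa using hb.measure_lt_top⟩
  have hi := (hc.memLp hb).integrable (by norm_num)
  obtain ⟨lo, hi', hlo, h⟩ := hc.bounds
  have hpos : 0 < volume.real Ω :=
    ENNReal.toReal_pos (hΩ.isOpen.measure_pos _ hΩ.isConnected.nonempty).ne' hb.measure_lt_top.ne
  calc 0 < volume.real Ω * lo := mul_pos hpos hlo
    _ = ∫ x in Ω, lo := by simp
    _ ≤ _ := integral_mono_ae (integrable_const _) hi (h.mono fun x hx => hx.1)

/-- Poincaré inequality under a weighted zero mean constraint. -/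
theorem exists_poincare {Ω : Set Plane} (hΩ : IsPolygonalDomain Ω) {μ : Plane → ℝ}
    (hμ : IsAdmissibleCoeff Ω μ) :
    ∃ C : ℝ, 0 < C ∧ ∀ q ∈ QSpace Ω μ, ∫ x in Ω, q x ^ 2 ≤ C * energy Ω q := by
  have hb := hΩ.isBounded
  have : IsFiniteMeasure (volume.restrict Ω) := ⟨by simpa using hb.measure_lt_top⟩
  obtain ⟨K, hK, hinc⟩ := hΩ.incrementBound
  have hm := hμ.integral_pos hΩ
  have hμ2 := hμ.memLp hb
  set m := ∫ x in Ω, μ x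
  set B := ∫ x in Ω, μ x ^ 2
  have hB0 : 0 ≤ B := integral_nonneg fun x => sq_nonneg _
  -- Cauchy–Schwarz gives the factor B / m² and the increment bound gives K; the summand 1 only
  -- ensures positivity.
  refine ⟨B * K.toReal / m ^ 2 + 1, by positivity, ?_⟩
  rintro q ⟨hq, -, -, hq0⟩
  have hq2 : MemLp q 2 (volume.restrict Ω) := Lp.memLp q
  have hpt (x : Plane) : ENNReal.ofReal (m ^ 2) * ‖q x‖ₑ ^ 2 ≤
      ENNReal.ofReal B * ∫⁻ y in Ω, ‖q x - q y‖ₑ ^ 2 := by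
    have hd : MemLp (fun y => q x - q y) 2 (volume.restrict Ω) := (memLp_const (q x)).sub hq2
    rw [lintegral_enorm_sq_eq hd, ← ENNReal.ofReal_mul hB0, Real.enorm_eq_ofReal_abs,
      ← ENNReal.ofReal_pow (abs_nonneg _), ← ENNReal.ofReal_mul (sq_nonneg _), sq_abs]
    refine ENNReal.ofReal_le_ofReal ?_
    -- The constraint ∫ μq = 0 enters here: it removes the term with q(y), and m ≠ 0 then lets q(x)
    -- be recovered from its increments.
    have e : ∫ y in Ω, μ y * (q x - q y) = m * q x := by
      have h1 : Integrable (fun y => μ y * q x) (volume.restrict Ω) :=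
        (hμ2.integrable (by norm_num)).mul_const _
      have h2 : Integrable (fun y => μ y * q y) (volume.restrict Ω) :=
        integrable_mul_of_memLp hμ2 hq2
      simp only [mul_sub]
      rw [integral_sub h1 h2, hq0, integral_mul_const, sub_zero]
    have hcs := abs_integral_mul_le_sqrt hμ2 hd
    rw [e] at hcs
    calc m ^ 2 * q x ^ 2 = |m * q x| ^ 2 := by rw [sq_abs, mul_pow]
      _ ≤ (√B * √(∫ y in Ω, (q x - q y) ^ 2)) ^ 2 := by gcongr
      _ = _ := by
        rw [mul_pow, Real.sq_sqrt hB0, Real.sq_sqrt (integral_nonneg fun x => sq_nonneg _)]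
  have hE := energy_nonneg Ω q
  have hall : ENNReal.ofReal (m ^ 2 * ∫ x in Ω, q x ^ 2) ≤
      ENNReal.ofReal (B * (K.toReal * energy Ω q)) := by
    rw [ENNReal.ofReal_mul (sq_nonneg _), ← lintegral_enorm_sq_eq hq2, ENNReal.ofReal_mul hB0,
      ENNReal.ofReal_mul ENNReal.toReal_nonneg, ENNReal.ofReal_toReal hK,
      ← lintegral_const_mul' _ _ ENNReal.ofReal_ne_top]
    refine (lintegral_mono hpt).trans ?_
    rw [lintegral_const_mul' _ _ ENNReal.ofReal_ne_top]
    gcongr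
    exact hinc q hq
  rw [ENNReal.ofReal_le_ofReal_iff (by positivity)] at hall
  have : ∫ x in Ω, q x ^ 2 ≤ B * (K.toReal * energy Ω q) / m ^ 2 := by
    rw [le_div_iff₀ (by positivity)]
    linarith
  calc _ ≤ _ := this
    _ = B * K.toReal / m ^ 2 * energy Ω q := by ring
    _ ≤ _ := by nlinarith

/-! ### Green's formula. -/

theorem tendsto_integral_inner {α E : Type*} [MeasurableSpace α] {ν : Measure α}
    [NormedAddCommGroup E] [InnerProductSpace ℝ E] {f g : α → E} {Φ : ℕ → α → E}
    (hf : MemLp f 2 ν) (hg : MemLp g 2 ν) (hΦ : ∀ n, MemLp (Φ n) 2 ν)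
    (h : Tendsto (fun n => eLpNorm (fun x => f x - Φ n x) 2 ν) atTop (𝓝 0)) :
    Tendsto (fun n => ∫ x, inner ℝ (Φ n x) (g x) ∂ν) atTop (𝓝 (∫ x, inner ℝ (f x) (g x) ∂ν)) := by
  have e {f : α → E} (hf : MemLp f 2 ν) :
      ∫ x, inner ℝ (f x) (g x) ∂ν = inner ℝ (hf.toLp f) (hg.toLp g) := by
    rw [L2.inner_def]
    refine integral_congr_ae ?_
    filter_upwards [hf.coeFn_toLp, hg.coeFn_toLp] with x hx hy
    rw [hx, hy]
  rw [e hf]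
  simp only [fun n => e (hΦ n)]
  have hlim : Tendsto (fun n => (hΦ n).toLp (Φ n)) atTop (𝓝 (hf.toLp f)) := by
    rw [Lp.tendsto_Lp_iff_tendsto_eLpNorm'']
    refine h.congr fun n => ?_
    exact eLpNorm_sub_comm f (Φ n) 2 ν
  exact hlim.inner tendsto_const_nhds

theorem IsTest.comp_coord {Ω : Set Plane} {Φ : Plane → Plane} (hΦ : IsTest Ω Φ) (i : Fin 2) :
    IsTest Ω fun x => Φ x i := by
  refine ⟨(EuclideanSpace.proj i : Plane →L[ℝ] ℝ).contDiff.comp hΦ.1,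
    hΦ.2.1.comp_left (g := fun v : Plane => v i) rfl,
    (closure_mono ?_).trans hΦ.2.2⟩
  intro x hx h
  exact hx (by simp [h])

theorem pderiv_coord {Ω : Set Plane} {Φ : Plane → Plane} (hΦ : IsTest Ω Φ) (i j : Fin 2)
    (x : Plane) : pderiv j (fun x => Φ x i) x = pderiv j Φ x i := by
  have h := ((EuclideanSpace.proj i : Plane →L[ℝ] ℝ).hasFDerivAt.comp x
    ((hΦ.1.differentiable (by simp)) x).hasFDerivAt).fderiv
  rw [pderiv, pderiv]
  exact congrArg (fun L => L (EuclideanSpace.single j 1)) h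

/-- The coordinates of Φ are admissible in the definition of the weak derivatives of q. The general
formula follows by L² convergence of the approximating fields and of their rotations. -/
theorem integral_inner_curl_of_isTest {Ω : Set Plane} {Φ : Plane → Plane} (hΦ : IsTest Ω Φ)
    {q : L2Scalar Ω} (hq : q ∈ H1 Ω) :
    ∫ x in Ω, inner ℝ (Φ x) (weakCurl Ω q x) = ∫ x in Ω, inner ℝ (classicalRot Φ x) (q x) := by
  have h0 := hasWeakPDeriv_weakPDeriv hq 0 _ (hΦ.comp_coord 1)
  have h1 := hasWeakPDeriv_weakPDeriv hq 1 _ (hΦ.comp_coord 0)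
  have i (j k : Fin 2) : Integrable (fun x => weakPDeriv Ω j q x * Φ x k) (volume.restrict Ω) :=
    integrable_mul_of_memLp (Lp.memLp _) (hΦ.comp_coord k).memLp
  have i' (j k : Fin 2) : Integrable (fun x => q x * pderiv j (fun x => Φ x k) x)
      (volume.restrict Ω) :=
    integrable_mul_of_memLp (Lp.memLp _) ((hΦ.comp_coord k).memLp_pderiv j)
  calc ∫ x in Ω, inner ℝ (Φ x) (weakCurl Ω q x)
      = ∫ x in Ω, (weakPDeriv Ω 1 q x * Φ x 0 - weakPDeriv Ω 0 q x * Φ x 1) := by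
        refine integral_congr_ae (ae_of_all _ fun x => ?_)
        simp [weakCurl, PiLp.inner_apply, Fin.sum_univ_two]
        ring
    _ = ∫ x in Ω, (q x * pderiv 0 (fun x => Φ x 1) x - q x * pderiv 1 (fun x => Φ x 0) x) := by
        rw [integral_sub (i _ _) (i _ _), integral_sub (i' _ _) (i' _ _), h0, h1]
        ring
    _ = _ := by
        refine integral_congr_ae (ae_of_all _ fun x => ?_)
        simp only [pderiv_coord hΦ, classicalRot, RCLike.inner_apply, conj_trivial]
        ring

/-- Green's formula for `v ∈ H₀(rot)` and `q ∈ H¹`. -/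
theorem integral_inner_curl {Ω : Set Plane} (hΩ : IsOpen Ω) {v : L2Vector Ω} (hv : v ∈ H0rot Ω)
    {q : L2Scalar Ω} (hq : q ∈ H1 Ω) :
    ∫ x in Ω, inner ℝ (v x) (weakCurl Ω q x) = ∫ x in Ω, weakRot Ω v x * q x := by
  obtain ⟨w, hw, Φ, hΦ, h1, h2⟩ := hv
  rw [weakRot_eq hΩ hw]
  have l1 := tendsto_integral_inner (Lp.memLp v) (memLp_weakCurl Ω q) (fun n => (hΦ n).memLp) h1
  have l2 := tendsto_integral_inner (Lp.memLp w) (Lp.memLp q) (fun n => (hΦ n).memLp_rot) h2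
  simp only [fun n => integral_inner_curl_of_isTest (hΦ n) hq] at l1
  rw [tendsto_nhds_unique l1 l2]
  simp [mul_comm]


/-! ### Weighted norms and coercivity. -/

theorem IsAdmissibleCoeff.exists_pos_bounds {Ω : Set Plane} {c : Plane → ℝ}
    (hc : IsAdmissibleCoeff Ω c) : ∃ lo hi : ℝ, 0 < lo ∧ 0 < hi ∧
      ∀ᵐ x ∂(volume.restrict Ω), lo ≤ c x ∧ c x ≤ hi := by
  obtain ⟨lo, hi, hlo, h⟩ := hc.bounds
  exact ⟨lo, max hi 1, hlo, by positivity, h.mono fun x hx => ⟨hx.1, hx.2.trans (le_max_left _ _)⟩⟩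

theorem IsAdmissibleCoeff.integrable_mul {Ω : Set Plane} {c f : Plane → ℝ}
    (hc : IsAdmissibleCoeff Ω c) (hf : Integrable f (volume.restrict Ω)) :
    Integrable (fun x => c x * f x) (volume.restrict Ω) := by
  obtain ⟨lo, hi, hlo, -, h⟩ := hc.exists_pos_bounds
  refine hf.bdd_mul (c := hi) hc.aemeasurable.aestronglyMeasurable ?_
  filter_upwards [h] with x hx
  rw [Real.norm_eq_abs, abs_of_pos (hlo.trans_le hx.1)]
  exact hx.2

theorem IsAdmissibleCoeff.inv {Ω : Set Plane} {c : Plane → ℝ} (hc : IsAdmissibleCoeff Ω c) :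
    IsAdmissibleCoeff Ω fun x => (c x)⁻¹ := by
  obtain ⟨lo, hi, hlo, hhi, h⟩ := hc.exists_pos_bounds
  refine ⟨hc.aemeasurable.inv, hi⁻¹, lo⁻¹, inv_pos.2 hhi, ?_⟩
  filter_upwards [h] with x hx
  exact ⟨inv_anti₀ (hlo.trans_le hx.1) hx.2, inv_anti₀ hlo hx.1⟩

/-- The weighted `L²` norm with weight `c⁻¹` controls the plain one. -/
theorem IsAdmissibleCoeff.exists_integral_le {Ω : Set Plane} {c : Plane → ℝ}
    (hc : IsAdmissibleCoeff Ω c) : ∃ M : ℝ, 0 < M ∧ ∀ f : Plane → ℝ, (∀ x, 0 ≤ f x) →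
      Integrable f (volume.restrict Ω) → ∫ x in Ω, f x ≤ M * ∫ x in Ω, (c x)⁻¹ * f x := by
  obtain ⟨lo, hi, hlo, hhi, h⟩ := hc.exists_pos_bounds
  refine ⟨hi, hhi, fun f hf0 hf => ?_⟩
  rw [← integral_const_mul]
  refine integral_mono_ae hf ((hc.inv.integrable_mul hf).const_mul _) ?_
  filter_upwards [h] with x hx
  have hpos := hlo.trans_le hx.1
  rw [← mul_assoc, ← div_eq_mul_inv]
  exact le_mul_of_one_le_left (hf0 x) ((one_le_div hpos).2 hx.2)

theorem integral_weight_nonneg {Ω : Set Plane} {c : Plane → ℝ} (hc : IsAdmissibleCoeff Ω c)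
    {f : Plane → ℝ} (hf : ∀ x, 0 ≤ f x) : 0 ≤ ∫ x in Ω, c x * f x := by
  obtain ⟨lo, hi, hlo, -, h⟩ := hc.exists_pos_bounds
  refine integral_nonneg_of_ae ?_
  filter_upwards [h] with x hx
  exact mul_nonneg (hlo.le.trans hx.1) (hf x)

/-- Expansion of the square in the least-squares functional. -/
theorem integral_residual_sq {Ω : Set Plane} {ε : Plane → ℝ} (hε : IsAdmissibleCoeff Ω ε)
    {v c : Plane → Plane} (hv : MemLp v 2 (volume.restrict Ω)) (hc : MemLp c 2 (volume.restrict Ω)) :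
    ∫ x in Ω, inner ℝ (√(ε x) • v x - (√(ε x))⁻¹ • c x) (√(ε x) • v x - (√(ε x))⁻¹ • c x) =
      (∫ x in Ω, ε x * inner ℝ (v x) (v x)) - 2 * (∫ x in Ω, inner ℝ (v x) (c x)) +
        ∫ x in Ω, (ε x)⁻¹ * inner ℝ (c x) (c x) := by
  have i1 := hε.integrable_mul (integrable_inner_of_memLp hv hv)
  have i2 := (integrable_inner_of_memLp hv hc).const_mul 2
  have i3 := hε.inv.integrable_mul (integrable_inner_of_memLp hc hc)
  rw [← integral_const_mul, ← integral_sub i1 i2, ← integral_add (by exact i1.sub i2) i3]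
  refine integral_congr_ae ?_
  obtain ⟨lo, hi, hlo, -, h⟩ := hε.exists_pos_bounds
  filter_upwards [h] with x hx
  have hpos := hlo.trans_le hx.1
  have hs : √(ε x) * √(ε x) = ε x := Real.mul_self_sqrt hpos.le
  have hs0 : √(ε x) ≠ 0 := (Real.sqrt_pos.2 hpos).ne'
  have hs1 : (√(ε x))⁻¹ * (√(ε x))⁻¹ = (ε x)⁻¹ := by rw [← mul_inv, hs]
  simp only [inner_sub_left, inner_sub_right, real_inner_smul_left, real_inner_smul_right]
  rw [real_inner_comm (v x) (c x)]
  linear_combination (inner ℝ (v x) (v x)) * hs + (inner ℝ (c x) (c x)) * hs1 -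
    2 * (inner ℝ (v x) (c x)) * mul_inv_cancel₀ hs0

/-- Young's inequality, integrated: s⁻¹(f - sg)² is nonnegative. -/
theorem two_mul_integral_mul_le {α : Type*} [MeasurableSpace α] {ν : Measure α} {f g : α → ℝ}
    (hf : MemLp f 2 ν) (hg : MemLp g 2 ν) {s : ℝ} (hs : 0 < s) :
    2 * ∫ x, f x * g x ∂ν ≤ s * (∫ x, g x ^ 2 ∂ν) + s⁻¹ * ∫ x, f x ^ 2 ∂ν := by
  rw [← integral_const_mul, ← integral_const_mul, ← integral_const_mul,
    ← integral_add (hg.integrable_sq.const_mul _) (hf.integrable_sq.const_mul _)]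
  refine integral_mono ((hf.integrable_mul hg).const_mul 2)
    ((hg.integrable_sq.const_mul _).add (hf.integrable_sq.const_mul _)) fun x => ?_
  have h : 0 ≤ s⁻¹ * (f x - s * g x) ^ 2 := by positivity
  have e : s⁻¹ * (f x - s * g x) ^ 2 = s * g x ^ 2 + s⁻¹ * f x ^ 2 - 2 * (f x * g x) := by
    field_simp
    ring
  simp only
  linarith

/-- A lower bound for `R + N`, where the mixed term hidden in `N` is controlled by `R`. -/
theorem coercive_of_mixed_bound {K R V P N : ℝ} (hK : 0 ≤ K) (hV : 0 ≤ V) (hR : 0 ≤ R)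
    (hN : 0 ≤ N) (hmix : V + P / 2 - K * R ≤ N) :
    1 / (4 * (1 + K)) * ((V + R) + P) ≤ R + N := by
  rw [div_mul_eq_mul_div, one_mul, div_le_iff₀ (by positivity)]
  -- Doubling the mixed bound gives V + P ≤ 2N + 2KR, hence V + R + P ≤ 2N + (1 + 2K)R, which is at
  -- most 4(1 + K)(R + N).
  nlinarith [mul_nonneg hK hR, mul_nonneg hK hN]

theorem exists_coercivity_constant {Ω : Set Plane} (hΩ : IsPolygonalDomain Ω) {ε μ : Plane → ℝ}
    (hε : IsAdmissibleCoeff Ω ε) (hμ : IsAdmissibleCoeff Ω μ) :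
    ∃ α : ℝ, 0 < α ∧ ∀ (v : H0rot Ω) (q : QSpace Ω μ),
      α * (normV Ω ε μ v ^ 2 + normQ Ω ε μ q ^ 2) ≤ lsForm Ω ε μ (v, q) (v, q) := by
  obtain ⟨C, hC, hpoin⟩ := exists_poincare hΩ hμ
  obtain ⟨A, hA, hεle⟩ := hε.exists_integral_le
  obtain ⟨B, hB, hμle⟩ := hμ.exists_integral_le
  -- C is the Poincaré constant; A and B compare the plain norms of curl q and rot v with the
  -- weighted ones. Young's inequality with parameter 1 / (2CA) bounds the q-term by P/2 and leaves
  -- 2CA‖rot v‖² ≤ K R.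
  set K := 2 * (C * A) * B with hKdef
  have hK : 0 ≤ K := by positivity
  refine ⟨1 / (4 * (1 + K)), by positivity, fun v q => ?_⟩
  have hc := memLp_weakCurl Ω q.1
  have hρ : MemLp (weakRot Ω v.1) 2 (volume.restrict Ω) := Lp.memLp _
  have hq : MemLp q.1 2 (volume.restrict Ω) := Lp.memLp _
  have hV0 : 0 ≤ ∫ x in Ω, ε x * inner ℝ (v.1 x) (v.1 x) :=
    integral_weight_nonneg hε fun x => real_inner_self_nonneg
  have hR0 : 0 ≤ ∫ x in Ω, (μ x)⁻¹ * (weakRot Ω v.1 x * weakRot Ω v.1 x) :=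
    integral_weight_nonneg hμ.inv fun x => mul_self_nonneg _
  have hP0 : 0 ≤ ∫ x in Ω, (ε x)⁻¹ * inner ℝ (weakCurl Ω q.1 x) (weakCurl Ω q.1 x) :=
    integral_weight_nonneg hε.inv fun x => real_inner_self_nonneg
  rw [normV, normQ, innerV, innerQ, Real.sq_sqrt (add_nonneg hV0 hR0), Real.sq_sqrt hP0]
  refine coercive_of_mixed_bound hK hV0 hR0 (integral_nonneg fun x => real_inner_self_nonneg) ?_
  have hexp := integral_residual_sq hε (Lp.memLp v.1) hc
  simp only at hexp ⊢
  -- Green's formula replaces (v, curl q) by (rot v, q), which R can absorb.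
  rw [hexp, integral_inner_curl hΩ.isOpen v.2 q.2.1]
  have hs : 0 < (2 * (C * A))⁻¹ := by positivity
  have hyoung := two_mul_integral_mul_le hρ hq hs
  have h1 := hpoin q.1 q.2
  have h2 := hεle _ (fun x => real_inner_self_nonneg) (integrable_inner_of_memLp hc hc)
  have h3 := hμle _ (fun x => mul_self_nonneg _) (integrable_mul_of_memLp hρ hρ)
  have h2' : energy Ω q.1 = ∫ x in Ω, inner ℝ (weakCurl Ω q.1 x) (weakCurl Ω q.1 x) := by
    simp only [energy, real_inner_self_eq_norm_sq]
  simp only [sq] at hyoung h1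
  rw [inv_inv] at hyoung
  rw [h2'] at h1
  have h4 : (2 * (C * A))⁻¹ * (∫ x in Ω, q.1 x * q.1 x) ≤
      (∫ x in Ω, (ε x)⁻¹ * inner ℝ (weakCurl Ω q.1 x) (weakCurl Ω q.1 x)) / 2 := by
    have := h1.trans (mul_le_mul_of_nonneg_left h2 hC.le)
    rw [inv_mul_le_iff₀ (by positivity)]
    linarith
  have h5 := mul_le_mul_of_nonneg_left h3 (show 0 ≤ 2 * (C * A) by positivity)
  rw [hKdef]
  linarith

end Maxwell2D

theorem mainTheorem3 (Ω : Set Maxwell2D.Plane) (hΩ : Maxwell2D.IsPolygonalDomain Ω)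
    (ε μ : Maxwell2D.Plane → ℝ) (hε : Maxwell2D.IsAdmissibleCoeff Ω ε)
    (hμ : Maxwell2D.IsAdmissibleCoeff Ω μ) :
    ∃ α : ℝ, 0 < α ∧ ∀ (v : Maxwell2D.H0rot Ω) (q : Maxwell2D.QSpace Ω μ),
      α * (Maxwell2D.normV Ω ε μ v ^ 2 + Maxwell2D.normQ Ω ε μ q ^ 2) ≤
        Maxwell2D.lsForm Ω ε μ (v, q) (v, q) :=
  Maxwell2D.exists_coercivity_constant hΩ hε hμ
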